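/- Fix a special sort $\mathtt{loc}$ of memory locations and countably many further sorts, countably many variables of every sort, and countably many constants of every sort other than $\mathtt{loc}$ (none of sort $\mathtt{loc}$). Formulas are interpreted over fixed pairwise disjoint countably infinite sets $U_s$, one for every sort $s$; the constants of each sort $s$ are mapped injectively into $U_s$. Every predicate symbol has a profile $(\mathtt{loc},s_2,\dots,s_n)$ with $n\ge 1$. A \emph{symbolic heap} is a formula $(\alpha_1 * \dots * \alpha_m)\curlywedge\xi$, where each spatial atom $\alpha_i$ is either $x\mapsto(t_1,\dots,t_k)$ or $p(x,t_1,\dots,t_n)$, with $x$ a variable of sort $\mathtt{loc}$, the $t_j$ variables or constants of the right sorts, and $\xi$ a conjunction of equations and disequations between terms of the same sort. Structures $(\mathfrak s,\mathfrak h)$ consist of a sort-preserving store $\mathfrak s$ and a finite partial function $\mathfrak h$ from $U_{\mathtt{loc}}$ to finite tuples of elements of $\bigcup_s U_s$. Satisfaction is the usual one of separation logic ($x\mapsto(t_1,\dots,t_k)$ holds iff $\mathfrak h$ consists of exactly this cell), where the predicates are interpreted by the least fixed point of a finite set $\mathfrak R$ of inductive rules. A \emph{sequent} $\lambda\vdash_{\mathfrak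 R}\gamma$, with $\lambda,\gamma$ symbolic heaps, is \emph{valid} if every structure that satisfies $\lambda$ modulo $\mathfrak R$ satisfies $\gamma$ modulo $\mathfrak R$. A \emph{$\mathtt P$-rule} is a rule \[p(x_1,\dots,x_n)\Leftarrow \bigl(x_1\mapsto(y_1,\dots,y_k) * q_1(z_1,\vec u_1) * \dots * q_m(z_m,\vec u_m)\bigr)\curlywedge\xi\] ($m\ge 0$, the variables $x_i$ pairwise distinct) such that: $\xi$ is a conjunction of disequations $u\not\approx v$ with $u\in\{x_1,\dots,x_n,y_1,\dots,y_k\}$ and $v\in\{y_1,\dots,y_k\}\setminus\{x_1,\dots,x_n\}$; the $z_i$ are pairwise distinct, and are exactly the variables of sort $\mathtt{loc}$ in $\{y_1,\dots,y_k\}\setminus\{x_1,\dots,x_n\}$; every component of every $\vec u_i$ is some $x_j$, some $y_j$ or a constant. A set $\mathfrak R$ of $\mathtt P$-rules is \emph{deterministic} if, for any two distinct rules $p(\vec x_i)\Leftarrow(x^i_1\mapsto\vec t_i*\phi_i)\curlywedge\xi_i$ ($i=1,2$) of $\mathfrak R$ with the same head $p$, renamed so that they share no variable, the formula $\vec x_1\approx\vec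 x_2\wedge\vec t_1\approx\vec t_2\wedge\xi_1\wedge\xi_2$ is unsatisfiable (where $\vec t_1\approx\vec t_2$ is false if the tuples differ in length or in the sorts of their components). A predicate is \emph{productive} if it has a rule in $\mathfrak R$ all of whose body predicates are productive (least such set). The \emph{out-going} positions are the least sets such that position $i$ of $p$, of sort $\mathtt{loc}$, is out-going if $\mathfrak R$ contains a rule $p(x_1,\dots,x_n)\Leftarrow\dots$ whose body contains a points-to atom $x_1\mapsto\vec t$ with $x_i$ in $\vec t$, or a predicate atom that has $x_i$ at an out-going position of its predicate. \textbf{Proposition.} Checking the validity of sequents $\lambda\vdash_{\mathfrak R}\gamma$ is $\mathrm{PSpace}$-hard under polynomial-time many-one reductions, even when restricted to sequents such that $\mathfrak R$ is a deterministic set of $\mathtt P$-rules, all variables occurring in $\lambda$, $\gamma$ and $\mathfrak R$ are of sort $\mathtt{loc}$, all predicate symbols occurring in the sequent are productive, and all their positions of sort $\mathtt{loc}$, except possibly the first, are out-going. That is, for every language $L$ in $\mathrm{PSpace}$ there is a polynomial-time computable function $f$ that maps every word $w$ to (the encoding of) a sequent $f(w)$ satisfying these restrictions, such that $w\in L$ if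 and only if $f(w)$ is valid. -/

import Mathlib

/-! ### Symbolic heaps: sorts, terms, atoms, formulas, rules, sequents -/

namespace SL

/-- Sorts: the special sort `loc` of memory locations, and countably many other sorts. -/
inductive Srt : Type
  | loc : Srt
  | data (n : ℕ) : Srt

/-- Variables: a countably infinite supply for every sort, pairwise disjoint. -/
structure Var : Type where
  sort : Srt
  idx : ℕ

/-- Terms are variables or constants. The constant `const d i` is the `i`-th constant of sort
`data d`; there is no constant of sort `loc`. -/
inductive Term : Type
  | var (v : Var) : Term
  | const (d i : ℕ) : Term

def Term.sort : Term → Srt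
  | .var v => v.sort
  | .const d _ => .data d

/-- The `i`-th variable of sort `loc`. -/
abbrev locVar (i : ℕ) : Var := ⟨.loc, i⟩

/-- A predicate symbol comes with its profile, which is `loc :: args`. -/
structure PredSym : Type where
  idx : ℕ
  args : List Srt

def PredSym.profile (p : PredSym) : List Srt := .loc :: p.args

/-- Spatial atoms `x ↦ (t₁, …, tₖ)` and `p(x, t₁, …, tₙ)`. The root `x` is always a variable of
sort `loc`, given by its index. -/
inductive Atom : Type
  | pointsTo (x : ℕ) (ts : List Term) : Atom
  | pred (p : PredSym) (x : ℕ) (ts : List Term) : Atom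

/-- Equations and disequations. -/
inductive PureAtom : Type
  | eq (t u : Term) : PureAtom
  | ne (t u : Term) : PureAtom

/-- A (non quantified) symbolic heap: the separating conjunction of the atoms in `spatial`
(`emp` if there is none), together with the conjunction of the (dis)equations in `pure`. -/
structure SymHeap : Type where
  spatial : List Atom
  pure : List PureAtom

/-- An inductive rule `head(root, params) ⇐ body`; the root is the loc variable of that index. -/
structure Rule : Type where
  head : PredSym
  root : ℕ
  params : List Var
  body : SymHeap

/-- The tuple `(x₁, …, xₙ)` of the formal parameters of a rule. -/
def Rule.vars (r : Rule) : List Var := locVar r.root :: r.params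

/-- A sequent `lhs ⊢ rhs` modulo the finite set of the rules in the list `rules`. -/
structure Sequent : Type where
  lhs : SymHeap
  rhs : SymHeap
  rules : List Rule

/-! ### Well-sortedness, and absence of variables of a sort other than `loc` -/

def Atom.WellSorted : Atom → Prop
  | .pointsTo _ _ => True
  | .pred p _ ts => ts.map Term.sort = p.args

def PureAtom.WellSorted : PureAtom → Prop
  | .eq t u => t.sort = u.sort
  | .ne t u => t.sort = u.sort

def SymHeap.WellSorted (H : SymHeap) : Prop :=
  (∀ a ∈ H.spatial, a.WellSorted) ∧ ∀ a ∈ H.pure, a.WellSorted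

def Rule.WellSorted (r : Rule) : Prop :=
  r.params.map Var.sort = r.head.args ∧ r.vars.Nodup ∧ r.body.WellSorted

def Sequent.WellSorted (S : Sequent) : Prop :=
  S.lhs.WellSorted ∧ S.rhs.WellSorted ∧ ∀ r ∈ S.rules, r.WellSorted

/-- If `t` is a variable, then it is of sort `loc`. -/
def Term.LocOnly (t : Term) : Prop := ∀ v, t = .var v → v.sort = .loc

def Atom.LocOnly : Atom → Prop
  | .pointsTo _ ts => ∀ t ∈ ts, t.LocOnly
  | .pred _ _ ts => ∀ t ∈ ts, t.LocOnly

def PureAtom.LocOnly : PureAtom → Prop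
  | .eq t u => t.LocOnly ∧ u.LocOnly
  | .ne t u => t.LocOnly ∧ u.LocOnly

def SymHeap.LocOnly (H : SymHeap) : Prop :=
  (∀ a ∈ H.spatial, a.LocOnly) ∧ ∀ a ∈ H.pure, a.LocOnly

def Rule.LocOnly (r : Rule) : Prop :=
  (∀ v ∈ r.params, v.sort = .loc) ∧ r.body.LocOnly

/-- All variables of the two formulas and of the rules are of sort `loc`. -/
def Sequent.LocOnly (S : Sequent) : Prop :=
  S.lhs.LocOnly ∧ S.rhs.LocOnly ∧ ∀ r ∈ S.rules, r.LocOnly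

/-! ### Semantics -/

/-- The fixed universe: a countably infinite set for every sort (they are made disjoint by taking
their disjoint sum), and an injective interpretation of the constants. -/
structure Interp where
  U : Srt → Type
  countable : ∀ s, Countable (U s)
  infinite : ∀ s, Infinite (U s)
  const : ∀ d : ℕ, ℕ → U (.data d)
  const_injective : ∀ d, Function.Injective (const d)

/-- Elements of the universe. -/
def Interp.Val (I : Interp) : Type := Σ s, I.U s

/-- Stores: sort-preserving assignments of the variables. -/
def Interp.Store (I : Interp) : Type := ∀ v : Var, I.U v.sort

variable {I : Interp}

def Interp.Store.eval (s : I.Store) : Term → I.Val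
  | .var v => ⟨v.sort, s v⟩
  | .const d i => ⟨.data d, I.const d i⟩

/-- Heaps: finite partial functions from locations to tuples of elements of the universe. -/
structure Interp.Heap (I : Interp) where
  map : I.U .loc → Option (List I.Val)
  finite_dom : {l | map l ≠ none}.Finite

def Interp.Heap.IsEmpty (h : I.Heap) : Prop := ∀ l, h.map l = none

/-- `h = {(l, v)}`. -/
def Interp.Heap.IsSingleton (h : I.Heap) (l : I.U .loc) (v : List I.Val) : Prop :=
  h.map l = some v ∧ ∀ k, k ≠ l → h.map k = none

/-- `h₁` and `h₂` are disjoint and `h` is their union. -/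
def Interp.Heap.IsDisjointUnion (h h₁ h₂ : I.Heap) : Prop :=
  (∀ l, h₁.map l = none ∨ h₂.map l = none) ∧ ∀ l, h.map l = (h₁.map l).or (h₂.map l)

def PureAtom.Sat (s : I.Store) : PureAtom → Prop
  | .eq t u => s.eval t = s.eval u
  | .ne t u => s.eval t ≠ s.eval u

/-- Satisfaction of a separating conjunction of spatial atoms modulo the rules `R` (least fixed
point). An atom `p(x, ts)` is unfolded by a rule for `p`: the store `s₁` maps the formal parameters
of the rule to the values of `x, ts` under `s` and is arbitrary on the existential variables, which
amounts to renaming the rule apart, instantiating its parameters, and changing `s` on the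
existential variables only. -/
inductive SatSpatial (R : List Rule) : I.Store → I.Heap → List Atom → Prop
  | emp {s : I.Store} {h : I.Heap} : h.IsEmpty → SatSpatial R s h []
  | pointsTo {s : I.Store} {h h₁ h₂ : I.Heap} {x : ℕ} {ts : List Term} {φ : List Atom} :
      h.IsDisjointUnion h₁ h₂ →
      h₁.IsSingleton (s (locVar x)) (ts.map s.eval) →
      SatSpatial R s h₂ φ →
      SatSpatial R s h (.pointsTo x ts :: φ)
  | pred {s s₁ : I.Store} {h h₁ h₂ : I.Heap} {r : Rule} {x : ℕ} {ts : List Term} {φ : List Atom} :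
      h.IsDisjointUnion h₁ h₂ →
      r ∈ R →
      r.vars.map (fun v => s₁.eval (.var v)) = (Term.var (locVar x) :: ts).map s.eval →
      (∀ a ∈ r.body.pure, a.Sat s₁) →
      SatSpatial R s₁ h₁ r.body.spatial →
      SatSpatial R s h₂ φ →
      SatSpatial R s h (.pred r.head x ts :: φ)

/-- `(s, h)` is a model of the symbolic heap `H` modulo the rules `R`. -/
def SymHeap.Sat (R : List Rule) (s : I.Store) (h : I.Heap) (H : SymHeap) : Prop :=
  SatSpatial R s h H.spatial ∧ ∀ a ∈ H.pure, a.Sat s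

/-- A sequent is valid iff it has no counter-model. -/
def Sequent.Valid (I : Interp) (S : Sequent) : Prop :=
  ¬ ∃ (s : I.Store) (h : I.Heap), S.lhs.Sat S.rules s h ∧ ¬ S.rhs.Sat S.rules s h

/-! ### P-rules, determinism, and the standing assumptions on sets of rules -/

/-- A P-rule is of the form
`p(x₁, …, xₙ) ⇐ (x₁ ↦ (y₁, …, yₖ) * q₁(z₁, u₁) * … * qₘ(zₘ, uₘ)) ⋏ ξ` up to the order of the atoms.
An element of `calls` is the triple of a predicate symbol `qᵢ`, the index of the loc variable `zᵢ`
and the tuple `uᵢ`. -/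
def Rule.IsPRule (r : Rule) : Prop :=
  r.WellSorted ∧
  ∃ (ys : List Term) (calls : List (PredSym × ℕ × List Term)),
    r.body.spatial.Perm
      (.pointsTo r.root ys :: calls.map (fun c => Atom.pred c.1 c.2.1 c.2.2)) ∧
    (∀ a ∈ r.body.pure, ∃ u v : Term, a = .ne u v ∧
      (u ∈ r.vars.map Term.var ∨ u ∈ ys) ∧ v ∈ ys ∧ v ∉ r.vars.map Term.var) ∧
    (calls.map (fun c => c.2.1)).Nodup ∧
    (∀ z : ℕ, z ∈ calls.map (fun c => c.2.1) ↔
      (Term.var (locVar z) ∈ ys ∧ locVar z ∉ r.vars)) ∧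
    (∀ c ∈ calls, ∀ t ∈ c.2.2,
      t ∈ r.vars.map Term.var ∨ t ∈ ys ∨ ∃ d i, t = .const d i)

/-- For any two distinct rules with the same head, the equations between their parameters and
between their points-to tuples are not jointly satisfiable with the pure parts of both rules. The
two rules are renamed apart by evaluating them in two independent stores; tuples of different
lengths or sorts have different values. -/
def Deterministic (I : Interp) (R : List Rule) : Prop :=
  ∀ r₁ ∈ R, ∀ r₂ ∈ R, r₁ ≠ r₂ → r₁.head = r₂.head →
    ∀ (y₁ y₂ : ℕ) (t₁ t₂ : List Term),
      .pointsTo y₁ t₁ ∈ r₁.body.spatial → .pointsTo y₂ t₂ ∈ r₂.body.spatial →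
      ¬ ∃ s₁ s₂ : I.Store,
          r₁.vars.map (fun v => s₁.eval (.var v)) = r₂.vars.map (fun v => s₂.eval (.var v)) ∧
          t₁.map s₁.eval = t₂.map s₂.eval ∧
          (∀ a ∈ r₁.body.pure, a.Sat s₁) ∧ ∀ a ∈ r₂.body.pure, a.Sat s₂

/-- Productive predicate symbols. -/
inductive Productive (R : List Rule) : PredSym → Prop
  | intro {r : Rule} : r ∈ R →
      (∀ q y ts, Atom.pred q y ts ∈ r.body.spatial → Productive R q) → Productive R r.head

/-- `OutParam R p i`: the parameter at position `i` (the root being at position `0`) is an out-going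
parameter of `p`. -/
inductive OutParam (R : List Rule) : PredSym → ℕ → Prop
  | pointsTo {r : Rule} {i : ℕ} {x : Var} {y : ℕ} {ts : List Term} :
      r ∈ R → r.vars[i]? = some x → x.sort = .loc →
      Atom.pointsTo y ts ∈ r.body.spatial → .var x ∈ ts → OutParam R r.head i
  | pred {r : Rule} {i j : ℕ} {x : Var} {q : PredSym} {y : ℕ} {ts : List Term} :
      r ∈ R → r.vars[i]? = some x → x.sort = .loc →
      Atom.pred q y ts ∈ r.body.spatial → OutParam R q j →
      (Term.var (locVar y) :: ts)[j]? = some (.var x) → OutParam R r.head i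

def SymHeap.HasPred (H : SymHeap) (p : PredSym) : Prop := ∃ x ts, Atom.pred p x ts ∈ H.spatial

/-- The predicate symbol `p` occurs in the sequent. -/
def Sequent.HasPred (S : Sequent) (p : PredSym) : Prop :=
  S.lhs.HasPred p ∨ S.rhs.HasPred p ∨ ∃ r ∈ S.rules, r.head = p ∨ r.body.HasPred p

/-- Well-formed sequents over a deterministic set of P-rules, with all variables of sort `loc`, in
which all predicate symbols are productive and have no useless parameter (all parameters of sort
`loc`, except possibly the root, are out-going). -/
structure Sequent.IsDetPLoc (I : Interp) (S : Sequent) : Prop where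
  wellSorted : S.WellSorted
  isPRule : ∀ r ∈ S.rules, r.IsPRule
  deterministic : Deterministic I S.rules
  locOnly : S.LocOnly
  productive : ∀ p, S.HasPred p → Productive S.rules p
  noUseless : ∀ p, S.HasPred p → ∀ i, 1 ≤ i → p.profile[i]? = some .loc → OutParam S.rules p i

end SL

/-! ### A binary encoding of sequents, of size linear in the total size of the symbols and indices
(natural numbers are written in unary) -/

/-- Self-delimiting binary codes. -/
structure BinCode (α : Type) where
  enc : α → List Bool
  dec : List Bool → Option (α × List Bool)
  dec_enc : ∀ a l, dec (enc a ++ l) = some (a, l)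

namespace BinCode

def natDec : List Bool → Option (ℕ × List Bool)
  | [] => none
  | false :: l => some (0, l)
  | true :: l => (natDec l).map fun x => (x.1 + 1, x.2)

/-- The code of `n` is `1ⁿ0`. -/
def nat : BinCode ℕ where
  enc n := List.replicate n true ++ [false]
  dec := natDec
  dec_enc n l := by
    induction n with
    | zero => rfl
    | succ n ih =>
      simp only [List.replicate_succ, List.cons_append, natDec]
      rw [ih]; rfl

def prod {α β : Type} (a : BinCode α) (b : BinCode β) : BinCode (α × β) where
  enc x := a.enc x.1 ++ b.enc x.2
  dec l := (a.dec l).bind fun x => (b.dec x.2).map fun y => ((x.1, y.1), y.2)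
  dec_enc x l := by simp [List.append_assoc, a.dec_enc, b.dec_enc]

def sumDec {α β : Type} (a : BinCode α) (b : BinCode β) : List Bool → Option ((α ⊕ β) × List Bool)
  | [] => none
  | false :: l => (a.dec l).map fun x => (.inl x.1, x.2)
  | true :: l => (b.dec l).map fun x => (.inr x.1, x.2)

def sum {α β : Type} (a : BinCode α) (b : BinCode β) : BinCode (α ⊕ β) where
  enc
    | .inl x => false :: a.enc x
    | .inr y => true :: b.enc y
  dec := sumDec a b
  dec_enc x l := by cases x <;> simp [sumDec, a.dec_enc, b.dec_enc]

def listEnc {α : Type} (a : BinCode α) : List α → List Bool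
  | [] => [false]
  | x :: xs => true :: (a.enc x ++ listEnc a xs)

def listDec {α : Type} (a : BinCode α) : ℕ → List Bool → Option (List α × List Bool)
  | 0, _ => none
  | _ + 1, [] => none
  | _ + 1, false :: l => some ([], l)
  | n + 1, true :: l =>
      (a.dec l).bind fun x => (listDec a n x.2).map fun y => (x.1 :: y.1, y.2)

theorem listDec_listEnc {α : Type} (a : BinCode α) (xs : List α) :
    ∀ (n : ℕ) (l : List Bool), (listEnc a xs).length ≤ n →
      listDec a n (listEnc a xs ++ l) = some (xs, l) := by
  induction xs with
  | nil =>
    intro n l hn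
    cases n with
    | zero => simp [listEnc] at hn
    | succ n => simp [listEnc, listDec]
  | cons x xs ih =>
    intro n l hn
    cases n with
    | zero => simp [listEnc] at hn
    | succ n =>
      have h : (listEnc a xs).length ≤ n := by
        simp only [listEnc, List.length_cons, List.length_append] at hn
        omega
      simp [listEnc, listDec, a.dec_enc, ih n l h]

/-- The code of `[x₁, …, xₙ]` is `1 x₁ 1 x₂ … 1 xₙ 0`. -/
def list {α : Type} (a : BinCode α) : BinCode (List α) where
  enc := listEnc a
  dec l := listDec a l.length l
  dec_enc xs l := listDec_listEnc a xs _ l (by simp)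

/-- The code of `x` is the code of `f x`, where `g` is a left inverse of `f`. -/
def via {α β : Type} (b : BinCode β) (f : α → β) (g : β → α) (h : ∀ x, g (f x) = x) :
    BinCode α where
  enc x := b.enc (f x)
  dec l := (b.dec l).map fun y => (g y.1, y.2)
  dec_enc x l := by simp [b.dec_enc, h]

def toEncoding {α : Type} (a : BinCode α) : Computability.Encoding α Bool where
  encode := a.enc
  decode l := (a.dec l).map Prod.fst
  decode_encode x := by
    have h := a.dec_enc x []
    rw [List.append_nil] at h
    simp [h]

end BinCode

namespace SL

def srtCode : BinCode Srt :=
  BinCode.nat.via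
    (fun | .loc => 0 | .data n => n + 1)
    (fun | 0 => .loc | n + 1 => .data n)
    (by intro x; cases x <;> rfl)

def varCode : BinCode Var :=
  (srtCode.prod BinCode.nat).via (fun v => (v.sort, v.idx)) (fun x => ⟨x.1, x.2⟩) (fun _ => rfl)

def termCode : BinCode Term :=
  (varCode.sum (BinCode.nat.prod BinCode.nat)).via
    (fun | .var v => .inl v | .const d i => .inr (d, i))
    (fun | .inl v => .var v | .inr x => .const x.1 x.2)
    (by intro x; cases x <;> rfl)

def predSymCode : BinCode PredSym :=
  (BinCode.nat.prod srtCode.list).via (fun p => (p.idx, p.args)) (fun x => ⟨x.1, x.2⟩)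
    (fun _ => rfl)

def atomCode : BinCode Atom :=
  ((BinCode.nat.prod termCode.list).sum
      (predSymCode.prod (BinCode.nat.prod termCode.list))).via
    (fun | .pointsTo x ts => .inl (x, ts) | .pred p x ts => .inr (p, x, ts))
    (fun | .inl y => .pointsTo y.1 y.2 | .inr y => .pred y.1 y.2.1 y.2.2)
    (by intro x; cases x <;> rfl)

def pureAtomCode : BinCode PureAtom :=
  ((termCode.prod termCode).sum (termCode.prod termCode)).via
    (fun | .eq t u => .inl (t, u) | .ne t u => .inr (t, u))
    (fun | .inl y => .eq y.1 y.2 | .inr y => .ne y.1 y.2)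
    (by intro x; cases x <;> rfl)

def symHeapCode : BinCode SymHeap :=
  (atomCode.list.prod pureAtomCode.list).via (fun H => (H.spatial, H.pure))
    (fun x => ⟨x.1, x.2⟩) (fun _ => rfl)

def ruleCode : BinCode Rule :=
  (predSymCode.prod (BinCode.nat.prod (varCode.list.prod symHeapCode))).via
    (fun r => (r.head, r.root, r.params, r.body))
    (fun x => ⟨x.1, x.2.1, x.2.2.1, x.2.2.2⟩) (fun _ => rfl)

def sequentCode : BinCode Sequent :=
  (symHeapCode.prod (symHeapCode.prod ruleCode.list)).via
    (fun S => (S.lhs, S.rhs, S.rules)) (fun x => ⟨x.1, x.2.1, x.2.2⟩) (fun _ => rfl)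

def sequentEncoding : Computability.Encoding Sequent Bool := sequentCode.toEncoding

end SL

/-! ### Polynomial space and polynomial-time many-one reductions -/

namespace Complexity

/-- Moves of the head. -/
inductive Move : Type
  | left : Move
  | stay : Move
  | right : Move

/-- Deterministic Turing machines with input alphabet `A` and one tape that is infinite to the
right; `trans q a = none` means that the machine halts. -/
structure TM (A : Type) where
  Q : Type
  Γ : Type
  finQ : Finite Q
  finΓ : Finite Γ
  input : A → Γ
  input_injective : Function.Injective input
  blank : Γ
  blank_ne_input : ∀ a, input a ≠ blank
  trans : Q → Γ → Option (Q × Γ × Move)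
  start : Q
  final : Set Q

variable {A : Type}

structure TM.Cfg (M : TM A) where
  state : M.Q
  head : ℕ
  tape : ℕ → M.Γ

/-- The head does not move when it is told to leave the tape on the left. -/
def Move.apply : Move → ℕ → ℕ
  | .left, n => n - 1
  | .stay, n => n
  | .right, n => n + 1

/-- The initial configuration: the word `w` followed by blanks, the head on the first cell. -/
def TM.init (M : TM A) (w : List A) : M.Cfg where
  state := M.start
  head := 0
  tape i := ((w.map M.input)[i]?).getD M.blank

/-- One step of the machine. -/
inductive TM.Step (M : TM A) : M.Cfg → M.Cfg → Prop
  | mk (c : M.Cfg) (q : M.Q) (b : M.Γ) (m : Move) :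
      M.trans c.state (c.tape c.head) = some (q, b, m) →
      TM.Step M c ⟨q, m.apply c.head, Function.update c.tape c.head b⟩

/-- `c` is reached by the run of `M` on `w`. -/
def TM.Reaches (M : TM A) (w : List A) (c : M.Cfg) : Prop :=
  Relation.ReflTransGen M.Step (M.init w) c

def TM.Cfg.Halted {M : TM A} (c : M.Cfg) : Prop := M.trans c.state (c.tape c.head) = none

/-- `M` halts on every word, and it does so in a final state exactly on the words of `L`. -/
def TM.Decides (M : TM A) (L : Language A) : Prop :=
  ∀ w, ∃ c, M.Reaches w c ∧ c.Halted ∧ (c.state ∈ M.final ↔ w ∈ L)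

/-- On every word of length `n`, the head of `M` only visits the first `S n` cells. -/
def TM.RunsInSpace (M : TM A) (S : ℕ → ℕ) : Prop :=
  ∀ w c, M.Reaches w c → c.head < S w.length

/-- The class PSpace. -/
def InPSpace (L : Language A) : Prop :=
  ∃ (M : TM A) (p : Polynomial ℕ), M.Decides L ∧ M.RunsInSpace fun n => p.eval n

/-- PSpace-hardness, under polynomial-time many-one reductions, of the problem `Yes`, even when its
instances are restricted to `Class`: every instance produced by a reduction belongs to `Class`. -/
def PSpaceHardOn {Inst : Type} (enc : Computability.Encoding Inst Bool)
    (Class Yes : Set Inst) : Prop :=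
  ∀ (A : Type) [Fintype A] (L : Language A), InPSpace L →
    ∃ f : List A → Inst,
      Nonempty (Turing.TM2ComputableInPolyTime (fun w : List A => w) enc.encode f) ∧
      ∀ w, f w ∈ Class ∧ (w ∈ L ↔ f w ∈ Yes)

end Complexity

/-!
A run of a Turing machine in polynomial space is turned into a sequent whose left-hand side
generates all *traces*, i.e. all lists of tape symbols, and whose right-hand side follows the
machine along a trace.

*The machine.* The tape of a machine that uses `S` cells is arranged in a cycle of length `S + 1`,
with an end marker between the last cell and the first one, and read from the head on (`cyc`).
Moving the head then rotates the cycle (`rot`), so that the head needs no address: only the state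
is kept in the predicate symbol, the tape is kept in the parameters, and the number of rules does
not depend on `S`. When the head would leave the tape on the left, it reaches the end marker and
returns (`next_of_step`).

*The sequent.* Symbols are represented by pairwise distinct locations `g`, which are forced to be
distinct by the allocation of a cell at each of them. The left-hand side is `trace(x, g) * tok(g₁)
* … * tok(g_K)`. Every cell of a trace but the last shows a constant `k`, the locations `g` and the
next cell.
The right-hand side `sim_q(x, g, tape)` reads the cell in one of two ways. If the symbol `c` under
the head is `k`, then the tuple `g` with its `k`-th component replaced by the location that stands
for `c` is again `g`, so that a rule whose cell contains this modified tuple applies, and the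
machine makes its step. Otherwise the `k`-th component is an existential variable that differs
from the location under the head; the rule that says so allocates all the locations of the cell,
which uses up the atoms `tok`, and accepts the rest of the trace whatever it is (an escape). The
two kinds of rules exclude each other by this disequation, and the other rules are told apart by
the constant in the cell, hence the rules are deterministic (`deterministic_rules`).

A trace that deviates from the run or ends before the machine halts makes `sim` succeed. Once the
machine accepts, an escape without disequation is allowed, and hence the sequent is valid
(`Accepts.predSat`). If the machine rejects, then there is no rule for the last symbol of the run
but the escape, and the trace of the run yields a counter-model (`Rejects.not_predSat`). A rule
that stores all the parameters in a cell which no trace contains makes the predicates productive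
and the parameters out-going.

*Polynomial time.* The code of the sequent is a concatenation of constant strings, of a
homomorphic image of the input, and of polynomially many copies of constant strings or of codes of
consecutive numbers. Such strings are written by programs of a small language with loops over
stacks (`Emits`), which are compiled to stack machines step by step (`Exec.code_run`).
-/

/-! ### A structured language for stack machines -/

namespace StackProg

open Turing

variable {K : Type} [DecidableEq K] {Γ : K → Type}

/-- Programs over the stacks `K`, where the stack `k` has alphabet `Γ k`. The loop
`forEach k body` pops the stack `k` until it is empty and runs `body a` for every popped
symbol `a`; the body may itself use the stack `k`. -/
inductive Prog (Γ : K → Type) : Type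
  | skip : Prog Γ
  | push (k : K) (a : Γ k) : Prog Γ
  | seq (P Q : Prog Γ) : Prog Γ
  | forEach (k : K) (body : Γ k → Prog Γ) : Prog Γ

/-- Big-step semantics with step counts: `Exec P S t S'` says that the program `P` turns the stacks
`S` into the stacks `S'` in `t` steps. -/
inductive Exec : Prog Γ → (∀ k, List (Γ k)) → ℕ → (∀ k, List (Γ k)) → Prop
  | skip (S) : Exec .skip S 1 S
  | push (k a S) : Exec (.push k a) S 1 (Function.update S k (a :: S k))
  | seq {P Q S S' S'' t t'} : Exec P S t S' → Exec Q S' t' S'' → Exec (.seq P Q) S (t + t') S''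
  | forEach_nil {k body S} : S k = [] → Exec (.forEach k body) S 1 S
  | forEach_cons {k body S S' S'' a l t t'} : S k = a :: l →
      Exec (body a) (Function.update S k l) t S' → Exec (.forEach k body) S' t' S'' →
      Exec (.forEach k body) S (1 + t + t') S''

/-- The labels of the code of a program. -/
def Lab : Prog Γ → Type
  | .skip => Unit
  | .push _ _ => Unit
  | .seq P Q => Lab P ⊕ Lab Q
  | .forEach k body => Option (Σ a : Γ k, Lab (body a))

/-- The label at which the code of a program is entered. -/
def entry : (P : Prog Γ) → Lab P
  | .skip => ()
  | .push _ _ => ()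
  | .seq P _ => .inl (entry P)
  | .forEach _ _ => none

instance labFintype [∀ k, Fintype (Γ k)] : (P : Prog Γ) → Fintype (Lab P)
  | .skip => inferInstanceAs (Fintype Unit)
  | .push _ _ => inferInstanceAs (Fintype Unit)
  | .seq P Q =>
    letI := labFintype P
    letI := labFintype Q
    inferInstanceAs (Fintype (Lab P ⊕ Lab Q))
  | .forEach k body =>
    letI := fun a => labFintype (body a)
    inferInstanceAs (Fintype (Option (Σ a : Γ k, Lab (body a))))

/-- The internal state of the compiled machine: the symbol that was popped last, if any, together
with its stack. -/
abbrev Reg (Γ : K → Type) : Type := Option (Σ k, Γ k)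

/-- The jump at the head of a loop over the stack `k`: to the code of the body for the symbol that
was just popped, and out of the loop if the stack was empty. -/
def loopTarget {Λ : Type} (k : K) (next : Λ) (target : Γ k → Λ) : Reg Γ → Λ
  | none => next
  | some x => if h : x.1 = k then target (h ▸ x.2) else next

/-- The code of a program that is placed in a machine with labels `Λ` along `emb`, and that
continues at the label `next`. -/
def code {Λ : Type} : (P : Prog Γ) → (Lab P → Λ) → Λ → Lab P → TM2.Stmt Γ Λ (Reg Γ)
  | .skip, _, next, _ => .goto fun _ => next
  | .push k a, _, next, _ => .push k (fun _ => a) (.goto fun _ => next)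
  | .seq P Q, emb, _, .inl l => code P (fun x => emb (.inl x)) (emb (.inr (entry Q))) l
  | .seq _ Q, emb, next, .inr l => code Q (fun x => emb (.inr x)) next l
  | .forEach k body, emb, next, none =>
      .pop k (fun _ o => o.map (Sigma.mk k))
        (.goto (loopTarget k next fun a => emb (some ⟨a, entry (body a)⟩)))
  | .forEach _ body, emb, _, some ⟨a, l⟩ =>
      code (body a) (fun x => emb (some ⟨a, x⟩)) (emb none) l

/-- The compiled code follows the big-step semantics, with the same number of steps. -/
theorem Exec.code_run {P : Prog Γ} {S S' : ∀ k, List (Γ k)} {t : ℕ} (h : Exec P S t S') :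
    ∀ {Λ : Type} (M : Λ → TM2.Stmt Γ Λ (Reg Γ)) (emb : Lab P → Λ) (next : Λ),
      (∀ l, M (emb l) = code P emb next l) → ∀ v, ∃ v',
        (flip bind (TM2.step M))^[t] (some ⟨some (emb (entry P)), v, S⟩) =
          some ⟨some next, v', S'⟩ := by
  induction h with
  | skip S =>
    intro Λ M emb next hM v
    refine ⟨v, ?_⟩
    simp [flip, hM, code]
  | push k a S =>
    intro Λ M emb next hM v
    refine ⟨v, ?_⟩
    simp [flip, hM, code]
  | @seq P Q S S' S'' t t' _ _ ih₁ ih₂ =>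
    intro Λ M emb next hM v
    obtain ⟨v₁, h₁⟩ := ih₁ M (fun x => emb (.inl x)) (emb (.inr (entry Q)))
      (fun l => hM (.inl l)) v
    obtain ⟨v₂, h₂⟩ := ih₂ M (fun x => emb (.inr x)) next (fun l => hM (.inr l)) v₁
    refine ⟨v₂, ?_⟩
    rw [Nat.add_comm, Function.iterate_add_apply]
    exact (congrArg _ h₁).trans h₂
  | @forEach_nil k body S hS =>
    intro Λ M emb next hM v
    refine ⟨none, ?_⟩
    have h0 : M (emb (entry (.forEach k body))) = _ := hM none
    have hup : Function.update S k [] = S := by rw [← hS]; exact Function.update_eq_self k S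
    simp [flip, h0, code, hS, loopTarget, hup]
  | @forEach_cons k body S S' S'' a l t t' hS _ _ ih₁ ih₂ =>
    intro Λ M emb next hM v
    have h0 : M (emb (entry (.forEach k body))) = _ := hM none
    obtain ⟨v₁, h₁⟩ := ih₁ M (fun x => emb (some ⟨a, x⟩)) (emb none)
      (fun l => hM (some ⟨a, l⟩)) (some ⟨k, a⟩)
    obtain ⟨v₂, h₂⟩ := ih₂ M emb next hM v₁
    refine ⟨v₂, ?_⟩
    rw [show 1 + t + t' = t' + (t + 1) by omega, Function.iterate_add_apply,
      Function.iterate_add_apply, Function.iterate_one]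
    rw [← h₂]
    congr 1
    refine Eq.trans ?_ h₁
    congr 1
    simp [flip, h0, code, hS, loopTarget]

/-- The Turing machine that runs the program `P` with input stack `i` and output stack `o`. -/
def machine [Fintype K] [∀ k, Fintype (Γ k)] (P : Prog Γ) (i o : K) : FinTM2 where
  k₀ := i
  k₁ := o
  Γ := Γ
  Λ := Option (Lab P)
  main := some (entry P)
  σ := Reg Γ
  initialState := none
  m
    | none => .load (fun _ => none) .halt
    | some l => code P some none l

/-- A program that turns the input stack into the output stack yields a halting run of its
machine. -/
theorem Exec.machine_run [Fintype K] [∀ k, Fintype (Γ k)] {P : Prog Γ} {i o : K} {t : ℕ}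
    {u : List (Γ i)} {v : List (Γ o)}
    (h : Exec P (initList (machine P i o) u).stk t (haltList (machine P i o) v).stk) :
    (flip bind (machine P i o).step)^[t + 1] (some (initList (machine P i o) u)) =
      some (haltList (machine P i o) v) := by
  obtain ⟨v', h'⟩ := h.code_run (machine P i o).m some none (fun l => rfl) none
  rw [Nat.add_comm, Function.iterate_add_apply]
  refine (congrArg _ h').trans ?_
  rfl

end StackProg

/-! ### Strings that are written in polynomial time -/

namespace StackProg

open Turing

/-- The stacks used below: the input, a stack holding the reversed input while the input is being
read, two unary counters, and the output. -/
inductive Stk : Type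
  | inp | rev | acc | tmp | out
  deriving DecidableEq

instance stkFintype : Fintype Stk where
  elems := {.inp, .rev, .acc, .tmp, .out}
  complete k := by cases k <;> simp

/-- The stack alphabets. -/
abbrev Alph (A : Type) : Stk → Type
  | .inp => A
  | .rev => A
  | .acc => Unit
  | .tmp => Unit
  | .out => Bool

instance alphFintype (A : Type) [Fintype A] : (k : Stk) → Fintype (Alph A k)
  | .inp => inferInstanceAs (Fintype A)
  | .rev => inferInstanceAs (Fintype A)
  | .acc => inferInstanceAs (Fintype Unit)
  | .tmp => inferInstanceAs (Fintype Unit)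
  | .out => inferInstanceAs (Fintype Bool)

variable {A : Type}

/-- The stacks with the given contents; the counters hold `a` and `b`. -/
def store (w r : List A) (a b : ℕ) (o : List Bool) : ∀ k, List (Alph A k)
  | .inp => w
  | .rev => r
  | .acc => List.replicate a ()
  | .tmp => List.replicate b ()
  | .out => o

section update

variable (w r w' : List A) (a b c : ℕ) (o o' : List Bool)

@[simp] theorem update_store_inp :
    Function.update (store w r a b o) .inp w' = store w' r a b o := by
  funext k; cases k <;> simp [store, Function.update]

@[simp] theorem update_store_rev :
    Function.update (store w r a b o) .rev w' = store w w' a b o := by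
  funext k; cases k <;> simp [store, Function.update]

@[simp] theorem update_store_acc :
    Function.update (store w r a b o) .acc (List.replicate c ()) = store w r c b o := by
  funext k; cases k <;> simp [store, Function.update]

@[simp] theorem update_store_tmp :
    Function.update (store w r a b o) .tmp (List.replicate c ()) = store w r a c o := by
  funext k; cases k <;> simp [store, Function.update]

@[simp] theorem update_store_out :
    Function.update (store w r a b o) .out o' = store w r a b o' := by
  funext k; cases k <;> simp [store, Function.update]

end update

section exec

variable {w r : List A} {a b : ℕ} {o : List Bool}

theorem exec_push_rev (x : A) :
    Exec (.push .rev x) (store w r a b o) 1 (store w (x :: r) a b o) := by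
  have := Exec.push (Γ := Alph A) .rev x (store w r a b o)
  rwa [show x :: store w r a b o .rev = x :: r from rfl, update_store_rev] at this

theorem exec_push_inp (x : A) :
    Exec (.push .inp x) (store w r a b o) 1 (store (x :: w) r a b o) := by
  have := Exec.push (Γ := Alph A) .inp x (store w r a b o)
  rwa [show x :: store w r a b o .inp = x :: w from rfl, update_store_inp] at this

theorem exec_push_acc :
    Exec (.push .acc ()) (store w r a b o) 1 (store w r (a + 1) b o) := by
  have := Exec.push (Γ := Alph A) .acc () (store w r a b o)
  rwa [show () :: store w r a b o .acc = List.replicate (a + 1) () from rfl,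
    update_store_acc] at this

theorem exec_push_tmp :
    Exec (.push .tmp ()) (store w r a b o) 1 (store w r a (b + 1) o) := by
  have := Exec.push (Γ := Alph A) .tmp () (store w r a b o)
  rwa [show () :: store w r a b o .tmp = List.replicate (b + 1) () from rfl,
    update_store_tmp] at this

theorem exec_push_out (x : Bool) :
    Exec (.push .out x) (store w r a b o) 1 (store w r a b (x :: o)) := by
  have := Exec.push (Γ := Alph A) .out x (store w r a b o)
  rwa [show x :: store w r a b o .out = x :: o from rfl, update_store_out] at this

/-- A loop over the first counter whose body has the effect `f` on the other stacks; the body for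
the counter value `j` takes at most `T` steps. -/
theorem exec_forEach_acc {body : Prog (Alph A)} {T : ℕ} (f : ℕ → ℕ × List Bool)
    (h : ∀ j < a, ∃ t ≤ T, Exec body (store w r j (f (j + 1)).1 (f (j + 1)).2) t
      (store w r j (f j).1 (f j).2)) :
    ∃ t ≤ a * (T + 1) + 1, Exec (.forEach .acc fun _ => body)
      (store w r a (f a).1 (f a).2) t (store w r 0 (f 0).1 (f 0).2) := by
  induction a with
  | zero => exact ⟨1, by omega, .forEach_nil rfl⟩
  | succ a ih =>
    obtain ⟨t, ht, h₁⟩ := h a (by omega)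
    obtain ⟨t', ht', h₂⟩ := ih fun j hj => h j (by omega)
    refine ⟨1 + t + t', by rw [Nat.succ_mul]; omega,
      .forEach_cons (a := ()) (l := List.replicate a ()) rfl ?_ h₂⟩
    rwa [update_store_acc]

/-- The second counter is added to the first one. -/
theorem exec_tmp_to_acc : ∃ t ≤ 2 * b + 1,
    Exec (.forEach .tmp fun _ => .push .acc ()) (store w r a b o) t (store w r (a + b) 0 o) := by
  induction b generalizing a with
  | zero => exact ⟨1, by omega, .forEach_nil rfl⟩
  | succ b ih =>
    obtain ⟨t', ht', h₂⟩ := ih (a := a + 1)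
    refine ⟨1 + 1 + t', by omega, .forEach_cons (a := ()) (l := List.replicate b ())
      (S' := store w r (a + 1) b o) rfl ?_ ?_⟩
    · rw [update_store_tmp]; exact exec_push_acc
    · rwa [show a + (b + 1) = a + 1 + b by omega]

/-- The input is moved to the stack `rev`, with one unit added to the second counter for every
symbol. -/
theorem exec_inp_to_rev_count : ∃ t ≤ 3 * w.length + 1,
    Exec (.forEach .inp fun x => .seq (.push .rev x) (.push .tmp ())) (store w r a b o) t
      (store [] (w.reverse ++ r) a (b + w.length) o) := by
  induction w generalizing r b with
  | nil => exact ⟨1, by omega, .forEach_nil rfl⟩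
  | cons x w ih =>
    obtain ⟨t', ht', h₂⟩ := ih (r := x :: r) (b := b + 1)
    refine ⟨1 + (1 + 1) + t', by simp only [List.length_cons]; omega,
      .forEach_cons (a := x) (l := w) (S' := store w (x :: r) a (b + 1) o) rfl ?_ ?_⟩
    · rw [update_store_inp]; exact .seq (exec_push_rev x) exec_push_tmp
    · simpa [Nat.add_assoc, Nat.add_comm 1] using h₂

theorem exec_inp_to_rev : ∃ t ≤ 2 * w.length + 1,
    Exec (.forEach .inp fun x => .push .rev x) (store w r a b o) t
      (store [] (w.reverse ++ r) a b o) := by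
  induction w generalizing r with
  | nil => exact ⟨1, by omega, .forEach_nil rfl⟩
  | cons x w ih =>
    obtain ⟨t', ht', h₂⟩ := ih (r := x :: r)
    refine ⟨1 + 1 + t', by simp only [List.length_cons]; omega,
      .forEach_cons (a := x) (l := w) (S' := store w (x :: r) a b o) rfl ?_ ?_⟩
    · rw [update_store_inp]; exact exec_push_rev x
    · simpa using h₂

theorem exec_rev_to_inp : ∃ t ≤ 2 * r.length + 1,
    Exec (.forEach .rev fun x => .push .inp x) (store w r a b o) t
      (store (r.reverse ++ w) [] a b o) := by
  induction r generalizing w with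
  | nil => exact ⟨1, by omega, .forEach_nil rfl⟩
  | cons x r ih =>
    obtain ⟨t', ht', h₂⟩ := ih (w := x :: w)
    refine ⟨1 + 1 + t', by simp only [List.length_cons]; omega,
      .forEach_cons (a := x) (l := r) (S' := store (x :: w) r a b o) rfl ?_ ?_⟩
    · rw [update_store_rev]; exact exec_push_inp x
    · simpa using h₂

end exec

/-- The first counter can be set to the value of a polynomial at the length of the input, in
polynomial time. The program follows Horner's scheme. -/
theorem exists_eval_prog (p : Polynomial ℕ) :
    ∃ (P : Prog (Alph A)) (q : Polynomial ℕ), ∀ (w : List A) (o : List Bool),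
      ∃ t ≤ q.eval w.length, Exec P (store w [] 0 0 o) t (store w [] (p.eval w.length) 0 o) := by
  induction p using Polynomial.recOnHorner with
  | M0 => exact ⟨.skip, 1, fun w o => ⟨1, by simp, by simpa using Exec.skip _⟩⟩
  | MC p n _ _ ih =>
    obtain ⟨P, q, h⟩ := ih
    clear * - h
    induction n with
    | zero => exact ⟨P, q, by simpa using h⟩
    | succ n ih =>
      obtain ⟨P', q', h'⟩ := ih
      refine ⟨.seq P' (.push .acc ()), q' + 1, fun w o => ?_⟩
      obtain ⟨t, ht, hP⟩ := h' w o
      refine ⟨t + 1, by simpa using ht, .seq hP ?_⟩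
      have := exec_push_acc (w := w) (r := []) (a := (p + Polynomial.C n).eval w.length) (b := 0)
        (o := o)
      simpa [Nat.add_assoc] using this
  | MX p _ ih =>
    obtain ⟨P, q, h⟩ := ih
    -- For every unit of the first counter, the length of the input is added to the second one.
    refine ⟨.seq P (.seq (.forEach .acc fun _ =>
        .seq (.forEach .inp fun x => .seq (.push .rev x) (.push .tmp ()))
          (.forEach .rev fun x => .push .inp x)) (.forEach .tmp fun _ => .push .acc ())),
      q + (p * (5 * .X + 3) + 1 + (2 * (p * .X) + 1)), fun w o => ?_⟩
    obtain ⟨t, ht, hP⟩ := h w o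
    set n := w.length with hn
    obtain ⟨t₁, ht₁, h₁⟩ := exec_forEach_acc (w := w) (r := []) (a := p.eval n)
      (body := .seq (.forEach .inp fun x => .seq (.push .rev x) (.push .tmp ()))
          (.forEach .rev fun x => .push .inp x)) (T := 5 * n + 2)
      (fun j => ((p.eval n - j) * n, o)) (by
        intro j hj
        obtain ⟨u, hu, h₂⟩ := exec_inp_to_rev_count (w := w) (r := []) (a := j)
          (b := (p.eval n - (j + 1)) * n) (o := o)
        obtain ⟨u', hu', h₃⟩ := exec_rev_to_inp (w := []) (r := w.reverse) (a := j)
          (b := (p.eval n - (j + 1)) * n + n) (o := o)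
        refine ⟨u + u', by simp only [List.length_reverse] at hu'; omega, .seq h₂ ?_⟩
        rw [show (p.eval n - j) = (p.eval n - (j + 1)) + 1 by omega, Nat.succ_mul]
        simpa using h₃)
    obtain ⟨t₂, ht₂, h₂⟩ := exec_tmp_to_acc (w := w) (r := []) (a := 0) (b := p.eval n * n) (o := o)
    refine ⟨t + (t₁ + t₂), ?_, .seq hP (.seq (by simpa using h₁) (by simpa using h₂))⟩
    simp only [Polynomial.eval_add, Polynomial.eval_mul, Polynomial.eval_X, Polynomial.eval_ofNat,
      Polynomial.eval_one]
    exact Nat.add_le_add ht (Nat.add_le_add ht₁ ht₂)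

/-- `Emits s`: some program writes the string `s w` in front of the output in polynomial time, and
leaves the other stacks as they are, where `w` is the input. -/
def Emits (s : List A → List Bool) : Prop :=
  ∃ (P : Prog (Alph A)) (q : Polynomial ℕ), ∀ (w : List A) (o : List Bool),
    ∃ t ≤ q.eval w.length, Exec P (store w [] 0 0 o) t (store w [] 0 0 (s w ++ o))

/-- Pushing a constant string. -/
theorem exists_push_prog (l : List Bool) : ∃ P : Prog (Alph A), ∀ w r a b o,
    Exec P (store w r a b o) (l.length + 1) (store w r a b (l ++ o)) := by
  induction l with
  | nil => exact ⟨.skip, fun _ _ _ _ _ => .skip _⟩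
  | cons x l ih =>
    obtain ⟨P, h⟩ := ih
    exact ⟨.seq P (.push .out x), fun w r a b o => .seq (h w r a b o) (exec_push_out x)⟩

theorem Emits.const (l : List Bool) : Emits (fun _ : List A => l) := by
  obtain ⟨P, h⟩ := exists_push_prog (A := A) l
  exact ⟨P, (l.length + 1 : ℕ), fun w o => ⟨_, by simp, h _ _ _ _ _⟩⟩

theorem Emits.append {s s' : List A → List Bool} (h : Emits s) (h' : Emits s') :
    Emits (fun w => s w ++ s' w) := by
  obtain ⟨P, q, h⟩ := h
  obtain ⟨P', q', h'⟩ := h'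
  refine ⟨.seq P' P, q + q', fun w o => ?_⟩
  obtain ⟨t', ht', h'⟩ := h' w o
  obtain ⟨t, ht, h⟩ := h w (s' w ++ o)
  exact ⟨t' + t, by rw [Polynomial.eval_add]; omega, by rw [List.append_assoc]; exact .seq h' h⟩

/-- A polynomial number of copies of a constant string. -/
theorem Emits.replicate (p : Polynomial ℕ) (l : List Bool) :
    Emits (fun w : List A => (List.replicate (p.eval w.length) l).flatten) := by
  obtain ⟨P, q, h⟩ := exists_eval_prog (A := A) p
  obtain ⟨B, hB⟩ := exists_push_prog (A := A) l
  refine ⟨.seq P (.forEach .acc fun _ => B), q + (p * (l.length + 2 : ℕ) + 1), fun w o => ?_⟩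
  obtain ⟨t, ht, hP⟩ := h w o
  obtain ⟨t₁, ht₁, h₁⟩ := exec_forEach_acc (w := w) (r := []) (a := p.eval w.length) (body := B)
    (T := l.length + 1)
    (fun j => (0, (List.replicate (p.eval w.length - j) l).flatten ++ o)) (by
      intro j hj
      refine ⟨_, le_rfl, ?_⟩
      rw [show p.eval w.length - j = (p.eval w.length - (j + 1)) + 1 by omega,
        List.replicate_succ, List.flatten_cons, List.append_assoc]
      exact hB _ _ _ _ _)
  refine ⟨t + t₁, ?_, .seq hP (by simpa using h₁)⟩
  simp only [Polynomial.eval_add, Polynomial.eval_mul, Polynomial.eval_natCast,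
    Polynomial.eval_one, Nat.cast_id]
  gcongr

/-- A unary counter is copied to the output, with the help of the second counter. -/
theorem exec_acc_to_out {w r : List A} {a : ℕ} {o : List Bool} : ∃ t ≤ 6 * a + 2,
    Exec (.seq (.forEach .acc fun _ => .seq (.push .tmp ()) (.push .out true))
      (.forEach .tmp fun _ => .push .acc ())) (store w r a 0 o) t
      (store w r a 0 (List.replicate a true ++ o)) := by
  obtain ⟨t₁, ht₁, h₁⟩ := exec_forEach_acc (w := w) (r := r) (a := a)
    (body := .seq (.push .tmp ()) (.push .out true)) (T := 2)
    (fun j => (a - j, List.replicate (a - j) true ++ o)) (by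
      intro j hj
      refine ⟨1 + 1, le_rfl, ?_⟩
      simp only []
      rw [show a - j = a - (j + 1) + 1 by omega]
      exact .seq exec_push_tmp (exec_push_out true))
  obtain ⟨t₂, ht₂, h₂⟩ := exec_tmp_to_acc (w := w) (r := r) (a := 0) (b := a)
    (o := List.replicate a true ++ o)
  exact ⟨t₁ + t₂, by omega, .seq (by simpa using h₁) (by simpa using h₂)⟩

/-- The unary codes of the numbers below a polynomial bound, with a constant string before and
after each of them. -/
theorem Emits.range (p : Polynomial ℕ) (l l' : List Bool) :
    Emits (fun w : List A => (List.range (p.eval w.length)).flatMap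
      fun j => l ++ (List.replicate j true ++ l')) := by
  obtain ⟨P, q, h⟩ := exists_eval_prog (A := A) p
  obtain ⟨B, hB⟩ := exists_push_prog (A := A) l
  obtain ⟨B', hB'⟩ := exists_push_prog (A := A) l'
  refine ⟨.seq P (.forEach .acc fun _ =>
      .seq B' (.seq (.seq (.forEach .acc fun _ => .seq (.push .tmp ()) (.push .out true))
      (.forEach .tmp fun _ => .push .acc ())) B)),
    q + (p * (6 * p + (l.length + l'.length + 5 : ℕ)) + 1), fun w o => ?_⟩
  obtain ⟨t, ht, hP⟩ := h w o
  set n := p.eval w.length with hn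
  obtain ⟨t₁, ht₁, h₁⟩ := exec_forEach_acc (w := w) (r := []) (a := n)
    (body := .seq B' (.seq (.seq (.forEach .acc fun _ => .seq (.push .tmp ()) (.push .out true))
      (.forEach .tmp fun _ => .push .acc ())) B))
    (T := 6 * n + (l.length + l'.length + 4))
    (fun j => (0, ((List.range n).drop j).flatMap
      (fun j => l ++ (List.replicate j true ++ l')) ++ o)) (by
      intro j hj
      simp only []
      rw [List.drop_eq_getElem_cons (l := List.range n) (i := j) (by simpa using hj)]
      simp only [List.getElem_range, List.flatMap_cons, List.append_assoc]
      obtain ⟨u, hu, h₂⟩ := exec_acc_to_out (w := w) (r := []) (a := j)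
        (o := l' ++ (((List.range n).drop (j + 1)).flatMap
          (fun j => l ++ (List.replicate j true ++ l')) ++ o))
      exact ⟨l'.length + 1 + (u + (l.length + 1)), by omega,
        .seq (hB' _ _ _ _ _) (.seq h₂ (hB _ _ _ _ _))⟩)
  refine ⟨t + t₁, ?_, .seq hP (by simpa [List.drop_eq_nil_of_le] using h₁)⟩
  simp only [Polynomial.eval_add, Polynomial.eval_mul, Polynomial.eval_natCast,
    Polynomial.eval_one, Polynomial.eval_ofNat, Nat.cast_id]
  rw [← hn]
  have : n * (6 * n + (l.length + l'.length + 4) + 1) =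
    n * (6 * n + (l.length + l'.length + 5)) := by ring
  omega

/-- The image of the input under a homomorphism of words. -/
theorem Emits.flatMap [Finite A] (g : A → List Bool) : Emits (fun w : List A => w.flatMap g) := by
  classical
  obtain ⟨C, hC⟩ : ∃ C, ∀ a, (g a).length ≤ C := by
    obtain ⟨C, hC⟩ := (Set.finite_range fun a => (g a).length).bddAbove
    exact ⟨C, fun a => hC ⟨a, rfl⟩⟩
  choose B hB using fun a => exists_push_prog (A := A) (g a)
  refine ⟨.seq (.forEach .inp fun x => .push .rev x)
    (.forEach .rev fun x => .seq (.push .inp x) (B x)),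
    (2 * .X + 1) + (.X * (C + 3 : ℕ) + 1), fun w o => ?_⟩
  obtain ⟨t, ht, h⟩ := exec_inp_to_rev (w := w) (r := []) (a := 0) (b := 0) (o := o)
  have key : ∀ (r w : List A) (o : List Bool), ∃ t ≤ r.length * (C + 3) + 1,
      Exec (.forEach .rev fun x => .seq (.push .inp x) (B x)) (store w r 0 0 o) t
        (store (r.reverse ++ w) [] 0 0 (r.reverse.flatMap g ++ o)) := by
    intro r
    induction r with
    | nil => exact fun w o => ⟨1, by omega, .forEach_nil rfl⟩
    | cons x r ih =>
      intro w o
      obtain ⟨t', ht', h₂⟩ := ih (x :: w) (g x ++ o)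
      refine ⟨1 + (1 + ((g x).length + 1)) + t', ?_,
        .forEach_cons (a := x) (l := r) (S' := store (x :: w) r 0 0 (g x ++ o)) rfl ?_ ?_⟩
      · have := hC x
        rw [List.length_cons, Nat.succ_mul]
        omega
      · rw [update_store_rev]; exact .seq (exec_push_inp x) (hB x _ _ _ _ _)
      · simpa using h₂
  obtain ⟨t₁, ht₁, h₁⟩ := key w.reverse [] o
  refine ⟨t + t₁, ?_, .seq (by simpa using h) (by simpa using h₁)⟩
  simp only [Polynomial.eval_add, Polynomial.eval_mul, Polynomial.eval_natCast,
    Polynomial.eval_one, Polynomial.eval_ofNat, Polynomial.eval_X, Nat.cast_id]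
  simp only [List.length_reverse] at ht₁
  omega

/-- A function is computable in polynomial time if the code of its value can be emitted. -/
theorem Emits.computable [Fintype A] {β : Type} {eb : β → List Bool} {f : List A → β}
    (h : Emits fun w => eb (f w)) :
    Nonempty (TM2ComputableInPolyTime (fun w : List A => w) eb f) := by
  obtain ⟨P, q, h⟩ := h
  have clear : ∀ (w : List A) (o : List Bool), Exec (.forEach .inp fun _ => .skip)
      (store w [] 0 0 o) (2 * w.length + 1) (store [] [] 0 0 o) := by
    intro w o
    induction w with
    | nil => exact .forEach_nil rfl
    | cons x w ih =>
      have : Exec (.forEach .inp fun _ => .skip) (store (x :: w) [] 0 0 o)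
          (1 + 1 + (2 * w.length + 1)) (store [] [] 0 0 o) :=
        .forEach_cons (a := x) (l := w) rfl (by rw [update_store_inp]; exact .skip _) ih
      rwa [show 1 + 1 + (2 * w.length + 1) = 2 * (x :: w).length + 1 by
        rw [List.length_cons]; omega] at this
  refine ⟨⟨⟨machine (.seq P (.forEach .inp fun _ => .skip)) .inp .out, Equiv.refl _,
    Equiv.refl _⟩, q + (2 * .X + 2), fun w => ?_⟩⟩
  have key : ∃ t ≤ q.eval w.length, Exec (.seq P (.forEach .inp fun _ => .skip))
      (store w [] 0 0 []) (t + (2 * w.length + 1)) (store [] [] 0 0 (eb (f w))) := by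
    obtain ⟨t, ht, hP⟩ := h w []
    rw [List.append_nil] at hP
    exact ⟨t, ht, .seq hP (clear w _)⟩
  let t := Classical.choose key
  have ht : t ≤ _ := (Classical.choose_spec key).1
  have hr := (Classical.choose_spec key).2
  refine ⟨⟨t + (2 * w.length + 1) + 1, ?_⟩, ?_⟩
  · have hi : (initList (machine (.seq P (.forEach .inp fun _ => .skip)) Stk.inp Stk.out) w).stk =
        store w [] 0 0 [] := by
      funext k; cases k <;> rfl
    have ho : (haltList (machine (.seq P (.forEach .inp fun _ => .skip)) Stk.inp Stk.out)
        (eb (f w))).stk = store [] [] 0 0 (eb (f w)) := by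
      funext k; cases k <;> rfl
    exact Exec.machine_run (P := .seq P (.forEach .inp fun _ => .skip)) (i := Stk.inp)
      (o := Stk.out) (u := w.map id) (v := (eb (f w)).map id) (t := t + (2 * w.length + 1))
      (by rw [List.map_id, List.map_id, hi, ho]; exact hr)
  · simp only [Polynomial.eval_add, Polynomial.eval_mul, Polynomial.eval_ofNat, Polynomial.eval_X]
    omega

end StackProg

/-! ### The sequent of a rotating machine -/

namespace SL

open Complexity

/-- What a machine with `Q` states and `K` symbols does in a given state on a given symbol: it
accepts, it rejects, or it changes its state, writes a symbol and moves its head. -/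
inductive Act (Q K : ℕ) : Type
  | go (q : Fin Q) (k : Fin K) (m : Move) : Act Q K
  | acc : Act Q K
  | rej : Act Q K

/-- The cyclic tape `c :: B ++ [l]` after its first cell, which is the cell under the head, has
received the content `c` and the head has moved. -/
def rot {α : Type} (m : Move) (c : α) (B : List α) (l : α) : List α :=
  match m with
  | .left => l :: c :: B
  | .stay => c :: (B ++ [l])
  | .right => B ++ [l, c]

@[simp] theorem length_rot {α : Type} (m : Move) (c : α) (B : List α) (l : α) :
    (rot m c B l).length = B.length + 2 := by
  cases m <;> simp [rot]

theorem map_rot {α β : Type} (f : α → β) (m : Move) (c : α) (B : List α) (l : α) :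
    (rot m c B l).map f = rot m (f c) (B.map f) (f l) := by
  cases m <;> simp [rot]

theorem mem_rot {α : Type} {m : Move} {c : α} {B : List α} {l a : α} :
    a ∈ rot m c B l ↔ a = c ∨ a ∈ B ∨ a = l := by
  cases m <;> simp [rot] <;> tauto

/-- The location variable of index `i`, as a term. -/
abbrev lv (i : ℕ) : Term := .var (locVar i)

/-- The constants in use; they are all of the first data sort. -/
abbrev ct (i : ℕ) : Term := .const 0 i

/-! The variables of the rules and of the sequent, given by their indices: `0` is the root, `gs` are
the locations that stand for the symbols, `ys` are the existential variables that stand for them,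
`hd`, `mid` and `lst` are the cells of the tape, and `nx` is the next cell of the trace. -/

abbrev gs (K : ℕ) : List ℕ := List.range' 1 K
abbrev ys (K : ℕ) : List ℕ := List.range' (K + 1) K
abbrev hd (K : ℕ) : ℕ := 2 * K + 1
abbrev lst (K : ℕ) : ℕ := 2 * K + 2
abbrev nx (K : ℕ) : ℕ := 2 * K + 3
abbrev mid (K m : ℕ) : List ℕ := List.range' (2 * K + 4) m

/-- The parameters, besides the root, of the predicates that simulate the machine. -/
abbrev simParams (K m : ℕ) : List ℕ := gs K ++ (hd K :: (mid K m ++ [lst K]))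

/-- A predicate that holds for a single cell that is mapped to the empty tuple. -/
def tokP : PredSym := ⟨0, []⟩

/-- The predicate for arbitrary traces, i.e. for lists of symbols. -/
def traceP (K : ℕ) : PredSym := ⟨1, List.replicate K .loc⟩

/-- The predicate that reads a trace while it simulates the machine, which is in state `q`. -/
def simP (K m q : ℕ) : PredSym := ⟨q + 2, List.replicate (K + (m + 2)) .loc⟩

/-- The rule with the root variable `0`, the further parameters `ps`, the points-to tuple `ts`, the
predicate atoms `calls`, and the pure part `ξ`. -/
def mkRule (p : PredSym) (ps : List ℕ) (ts : List Term) (calls : List (PredSym × ℕ × List Term))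
    (ξ : List PureAtom) : Rule :=
  ⟨p, 0, ps.map locVar,
    ⟨.pointsTo 0 ts :: calls.map (fun c => .pred c.1 c.2.1 c.2.2), ξ⟩⟩

def tokRule : Rule := mkRule tokP [] [] [] []

/-- A trace may continue with any symbol. -/
def traceStep (K k : ℕ) : Rule :=
  mkRule (traceP K) (gs K) (ct k :: ((gs K).map lv ++ [lv (nx K)]))
    [(traceP K, nx K, (gs K).map lv)] []

/-- A trace may end at any time. -/
def traceEnd (K : ℕ) : Rule :=
  mkRule (traceP K) (gs K) (ct K :: (gs K).map lv) [] []

/-- The simulation succeeds when the trace ends. -/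
def simEnd (K m q : ℕ) : Rule :=
  mkRule (simP K m q) (simParams K m) (ct K :: (ys K).map lv)
    ((ys K).map fun y => (tokP, y, [])) []

/-- A cell that occurs in no trace; this rule makes all parameters out-going. -/
def simDump (K m q : ℕ) : Rule :=
  mkRule (simP K m q) (simParams K m) (ct (K + 1) :: (simParams K m).map lv) [] []

/-- The simulation succeeds, whatever the remaining trace, if the trace shows a symbol for which the
disequations `ξ` hold. -/
def simEscape (K m q k : ℕ) (ξ : List PureAtom) : Rule :=
  mkRule (simP K m q) (simParams K m) (ct k :: ((ys K).map lv ++ [lv (nx K)]))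
    ((traceP K, nx K, (ys K).map lv) :: (ys K).map fun y => (tokP, y, [])) ξ

/-- The symbol shown by the trace differs from the symbol under the head. -/
def mismatch (K k : ℕ) : PureAtom := .ne (lv (hd K)) (lv (K + 1 + k))

/-- The trace shows the symbol under the head, and the machine makes one step. -/
def simStep (K m q k q' k' : ℕ) (mv : Move) : Rule :=
  mkRule (simP K m q) (simParams K m)
    (ct k :: (((gs K).set k (hd K)).map lv ++ [lv (nx K)]))
    [(simP K m q', nx K, (gs K ++ rot mv (1 + k') (mid K m) (lst K)).map lv)] []

/-- The rules of the simulation for a given action in state `q` on symbol `k`. -/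
def actRules {Q K : ℕ} (m q k : ℕ) : Act Q K → List Rule
  | .acc => [simEscape K m q k []]
  | .rej => [simEscape K m q k [mismatch K k]]
  | .go q' k' mv => [simEscape K m q k [mismatch K k], simStep K m q k q' k' mv]

variable {Q K : ℕ}

/-- The rules for a machine with the transition function `δ` whose tape has `m + 2` cells. -/
def rules (δ : Fin Q → Fin K → Act Q K) (m : ℕ) : List Rule :=
  tokRule :: traceEnd K :: ((List.finRange K).map (fun k : Fin K => traceStep K k) ++
    (List.finRange Q).flatMap fun q : Fin Q => simEnd K m q :: simDump K m q ::
      (List.finRange K).flatMap fun k : Fin K => actRules m q k (δ q k))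

/-- The sequent for a machine with initial state `q₀` and initial cyclic tape `L`: every trace makes
the simulation succeed. -/
def sequent (δ : Fin Q → Fin K → Act Q K) (m : ℕ) (q₀ : Fin Q) (L : List (Fin K)) : Sequent where
  lhs := ⟨.pred (traceP K) 0 ((gs K).map lv) :: (gs K).map (fun y => .pred tokP y []), []⟩
  rhs := ⟨[.pred (simP K m q₀) 0 ((gs K).map lv ++ L.map fun k : Fin K => lv (1 + k))], []⟩
  rules := rules δ m

theorem mem_rules {δ : Fin Q → Fin K → Act Q K} {m : ℕ} {r : Rule} :
    r ∈ rules δ m ↔ r = tokRule ∨ r = traceEnd K ∨ (∃ k : Fin K, r = traceStep K k) ∨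
      ∃ q : Fin Q, r = simEnd K m q ∨ r = simDump K m q ∨
        ∃ k : Fin K, r ∈ actRules m q k (δ q k) := by
  simp only [rules, List.mem_cons, List.mem_append, List.mem_map, List.mem_flatMap,
    List.mem_finRange, true_and, eq_comm]

/-- The shapes of the rules for the actions. -/
theorem mem_actRules {m q k : ℕ} {a : Act Q K} {r : Rule} (h : r ∈ actRules m q k a) :
    (a = .acc ∧ r = simEscape K m q k []) ∨ (a ≠ .acc ∧ r = simEscape K m q k [mismatch K k]) ∨
      ∃ q' k' mv, a = .go q' k' mv ∧ r = simStep K m q k q' k' mv := by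
  cases a <;> simp [actRules] at h ⊢ <;> grind

/-! ### The sequent belongs to the restricted class -/

theorem mkRule_isPRule {p : PredSym} {ps : List ℕ} {ts : List Term}
    {calls : List (PredSym × ℕ × List Term)} {ξ : List PureAtom}
    (hp : p.args = List.replicate ps.length .loc) (hps : ps.Nodup) (h0 : 0 ∉ ps)
    (hcw : ∀ c ∈ calls, c.2.2.map Term.sort = c.1.args)
    (hξ : ∀ a ∈ ξ, ∃ u v : ℕ, a = .ne (lv u) (lv v) ∧ u ∈ ps ∧ lv v ∈ ts ∧ v ≠ 0 ∧ v ∉ ps)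
    (hnd : (calls.map fun c => c.2.1).Nodup)
    (hz : ∀ z, z ∈ calls.map (fun c => c.2.1) ↔ lv z ∈ ts ∧ z ≠ 0 ∧ z ∉ ps)
    (hu : ∀ c ∈ calls, ∀ t ∈ c.2.2, t ∈ ps.map lv ∨ t ∈ ts) :
    (mkRule p ps ts calls ξ).IsPRule := by
  have hinj : Function.Injective locVar := fun i j h => by simpa using h
  have hvars : (mkRule p ps ts calls ξ).vars = (0 :: ps).map locVar := rfl
  have hmem : ∀ z, locVar z ∈ (mkRule p ps ts calls ξ).vars ↔ z = 0 ∨ z ∈ ps := by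
    intro z
    rw [hvars, List.mem_map_of_injective hinj, List.mem_cons]
  have hmem' : ∀ z, lv z ∈ (mkRule p ps ts calls ξ).vars.map Term.var ↔ z = 0 ∨ z ∈ ps := by
    intro z
    rw [List.mem_map_of_injective (fun i j h => by simpa using h), hmem]
  refine ⟨⟨?_, ?_, ?_, ?_⟩, ts, calls, .refl _, ?_, hnd, ?_, ?_⟩
  · simp only [mkRule, hp, List.map_map]
    exact List.map_const' ..
  · rw [hvars]
    exact (List.nodup_cons.2 ⟨h0, hps⟩).map hinj
  · intro a ha
    simp only [mkRule, List.mem_cons, List.mem_map] at ha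
    obtain rfl | ⟨c, hc, rfl⟩ := ha
    · trivial
    · exact hcw c hc
  · intro a ha
    obtain ⟨u, v, rfl, -⟩ := hξ a ha
    rfl
  · intro a ha
    obtain ⟨u, v, rfl, hu, hv, hv0, hvp⟩ := hξ a ha
    exact ⟨_, _, rfl, .inl ((hmem' u).2 (.inr hu)), hv, by rw [hmem']; tauto⟩
  · intro z
    rw [hz, hmem, not_or]
  · intro c hc t ht
    rcases hu c hc t ht with h | h
    · refine .inl ?_
      rw [hvars, List.map_cons, List.map_cons, List.map_map]
      exact List.mem_cons_of_mem _ h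
    · exact .inr (.inl h)

theorem sort_map_lv (l : List ℕ) : (l.map lv).map Term.sort = List.replicate l.length .loc := by
  rw [List.map_map]
  exact List.map_const' ..

theorem nodup_simParams (K m : ℕ) : (simParams K m).Nodup := by
  have h₁ : (gs K).Nodup := List.nodup_range'
  have h₂ : (mid K m).Nodup := List.nodup_range'
  simp only [List.nodup_append, List.nodup_cons, h₁, h₂, List.mem_append,
    List.mem_cons, List.mem_range'_1, hd, lst]
  simp
  grind

theorem mem_simParams {K m z : ℕ} : z ∈ simParams K m ↔
    (1 ≤ z ∧ z < 1 + K) ∨ z = 2 * K + 1 ∨ (2 * K + 4 ≤ z ∧ z < 2 * K + 4 + m) ∨ z = 2 * K + 2 := by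
  simp [List.mem_range'_1]

theorem length_simParams (K m : ℕ) : (simParams K m).length = K + (m + 2) := by
  simp

theorem lv_injective : Function.Injective lv := fun i j h => by simpa using h

theorem isPRule_of_mem {δ : Fin Q → Fin K → Act Q K} {m : ℕ} {r : Rule} (hr : r ∈ rules δ m) :
    r.IsPRule := by
  rw [mem_rules] at hr
  have tokSort : ∀ {c : PredSym × ℕ × List Term}, (∃ y ∈ ys K, (tokP, y, []) = c) →
      c.2.2.map Term.sort = c.1.args := by
    rintro c ⟨y, -, rfl⟩; rfl
  obtain rfl | rfl | ⟨k, rfl⟩ | ⟨q, rfl | rfl | ⟨k, hr⟩⟩ := hr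
  · exact mkRule_isPRule rfl (by simp) (by simp) (by simp) (by simp) (by simp) (by simp) (by simp)
  · refine mkRule_isPRule (by simp [traceP]) List.nodup_range' (by simp) (by simp) (by simp)
      (by simp) ?_ (by simp)
    intro z
    simp
    omega
  · refine mkRule_isPRule (by simp [traceP]) List.nodup_range' (by simp) ?_ (by simp)
      (by simp) ?_ ?_
    · simp only [List.mem_singleton]
      rintro c rfl
      simp [sort_map_lv, traceP, - List.map_map]
    · intro z
      simp [nx]
      omega
    · simp only [List.mem_singleton]
      rintro c rfl t ht
      exact .inl ht
  · refine mkRule_isPRule (by rw [length_simParams]; rfl) (nodup_simParams K m)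
      (by rw [mem_simParams]; omega) (fun c hc => tokSort (List.mem_map.1 hc)) (by simp) ?_ ?_ ?_
    · simpa [Function.comp_def] using List.nodup_range'
    · intro z
      rw [mem_simParams]
      simp
      omega
    · intro c hc
      obtain ⟨y, -, rfl⟩ := List.mem_map.1 hc
      simp
  · refine mkRule_isPRule (by rw [length_simParams]; rfl) (nodup_simParams K m)
      (by rw [mem_simParams]; omega) (by simp) (by simp) (by simp) ?_ (by simp)
    intro z
    rw [List.mem_cons, List.mem_map_of_injective lv_injective]
    simp only [List.map_nil, List.not_mem_nil, false_iff]
    rintro ⟨h | h, -, h'⟩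
    · cases h
    · exact h' h
  · have esc : ∀ ξ : List PureAtom, (∀ a ∈ ξ, a = mismatch K k) →
        (simEscape K m q k ξ).IsPRule := by
      intro ξ hξ
      refine mkRule_isPRule (by rw [length_simParams]; rfl) (nodup_simParams K m)
        (by rw [mem_simParams]; omega) ?_ ?_ ?_ ?_ ?_
      · rw [List.forall_mem_cons]
        exact ⟨by simp [sort_map_lv, traceP, - List.map_map],
          fun c hc => tokSort (List.mem_map.1 hc)⟩
      · intro a ha
        refine ⟨_, _, hξ a ha, ?_, ?_, by omega, ?_⟩
        · simp
        · exact List.mem_cons_of_mem _ (List.mem_append_left _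
            (List.mem_map_of_mem (List.mem_range'_1.2 (by omega))))
        · rw [mem_simParams]; omega
      · rw [List.map_cons, List.map_map, List.nodup_cons]
        refine ⟨?_, ?_⟩
        · simp [nx]
          omega
        · exact by simpa [Function.comp_def] using List.nodup_range'
      · intro z
        rw [mem_simParams]
        simp [nx]
        omega
      · rw [List.forall_mem_cons]
        refine ⟨fun t ht => .inr ?_, fun c hc => ?_⟩
        · exact List.mem_cons_of_mem _ (List.mem_append_left _ ht)
        · obtain ⟨y, -, rfl⟩ := List.mem_map.1 hc
          simp
    obtain ⟨-, rfl⟩ | ⟨-, rfl⟩ | ⟨q', k', mv, -, rfl⟩ := mem_actRules hr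
    · exact esc _ (by simp)
    · exact esc _ (by simp)
    · refine mkRule_isPRule (by rw [length_simParams]; rfl) (nodup_simParams K m)
        (by rw [mem_simParams]; omega) ?_ (by simp) (by simp) ?_ ?_
      · simp only [List.mem_singleton]
        rintro c rfl
        simp only [sort_map_lv, simP]
        simp
      · intro z
        rw [mem_simParams]
        simp only [List.mem_cons, List.mem_append, List.mem_map_of_injective lv_injective,
          List.map_cons, List.map_nil, List.not_mem_nil, or_false, reduceCtorEq, false_or,
          lv_injective.eq_iff]
        constructor
        · rintro rfl
          exact ⟨.inr rfl, by simp [nx], by simp only [nx]; omega⟩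
        · rintro ⟨h | h, h', h''⟩
          · rcases List.mem_or_eq_of_mem_set h with h | h
            · rw [List.mem_range'_1] at h; omega
            · simp only [hd] at h; omega
          · exact h
      · simp only [List.mem_singleton]
        rintro c rfl t ht
        refine .inl ?_
        obtain ⟨i, hi, rfl⟩ := List.mem_map.1 ht
        rw [List.mem_map_of_injective lv_injective, mem_simParams]
        rw [List.mem_append, mem_rot, List.mem_range'_1, List.mem_range'_1] at hi
        simp only [lst] at hi
        have := k'.2
        omega

theorem preds_of_mem_rules {δ : Fin Q → Fin K → Act Q K} {m : ℕ} {r : Rule} (hr : r ∈ rules δ m) :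
    (r.head = tokP ∨ r.head = traceP K ∨ ∃ q : Fin Q, r.head = simP K m q) ∧
      ∀ p, r.body.HasPred p → p = tokP ∨ p = traceP K ∨ ∃ q : Fin Q, p = simP K m q := by
  have body : ∀ {p p' ps ts calls ξ}, (mkRule p' ps ts calls ξ).body.HasPred p →
      ∃ c ∈ calls, c.1 = p := by
    rintro p p' ps ts calls ξ ⟨x, us, h⟩
    simp only [mkRule, List.mem_cons, reduceCtorEq, false_or, List.mem_map] at h
    obtain ⟨c, hc, h⟩ := h
    exact ⟨c, hc, by simp at h; exact h.1⟩
  rw [mem_rules] at hr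
  obtain rfl | rfl | ⟨k, rfl⟩ | ⟨q, rfl | rfl | ⟨k, hr⟩⟩ := hr
  · exact ⟨.inl rfl, fun p hp => by obtain ⟨c, hc, rfl⟩ := body hp; simp at hc⟩
  · exact ⟨.inr (.inl rfl), fun p hp => by obtain ⟨c, hc, rfl⟩ := body hp; simp at hc⟩
  · refine ⟨.inr (.inl rfl), fun p hp => ?_⟩
    obtain ⟨c, hc, rfl⟩ := body hp
    rw [List.mem_singleton] at hc
    exact .inr (.inl (by rw [hc]))
  · refine ⟨.inr (.inr ⟨q, rfl⟩), fun p hp => ?_⟩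
    obtain ⟨c, hc, rfl⟩ := body hp
    obtain ⟨y, -, rfl⟩ := List.mem_map.1 hc
    exact .inl rfl
  · exact ⟨.inr (.inr ⟨q, rfl⟩), fun p hp => by obtain ⟨c, hc, rfl⟩ := body hp; simp at hc⟩
  · have esc : ∀ ξ p, (simEscape K m q k ξ).body.HasPred p → p = tokP ∨ p = traceP K := by
      intro ξ p hp
      obtain ⟨c, hc, rfl⟩ := body hp
      rw [List.mem_cons] at hc
      obtain rfl | hc := hc
      · exact .inr rfl
      · obtain ⟨y, -, rfl⟩ := List.mem_map.1 hc
        exact .inl rfl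
    obtain ⟨-, rfl⟩ | ⟨-, rfl⟩ | ⟨q', k', mv, -, rfl⟩ := mem_actRules hr
    · exact ⟨.inr (.inr ⟨q, rfl⟩), fun p hp => (esc _ p hp).imp_right .inl⟩
    · exact ⟨.inr (.inr ⟨q, rfl⟩), fun p hp => (esc _ p hp).imp_right .inl⟩
    · refine ⟨.inr (.inr ⟨q, rfl⟩), fun p hp => ?_⟩
      obtain ⟨c, hc, rfl⟩ := body hp
      rw [List.mem_singleton] at hc
      exact .inr (.inr ⟨q', by rw [hc]⟩)

theorem hasPred_sequent {δ : Fin Q → Fin K → Act Q K} {m : ℕ} {q₀ : Fin Q} {L : List (Fin K)}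
    {p : PredSym} (h : (sequent δ m q₀ L).HasPred p) :
    p = tokP ∨ p = traceP K ∨ ∃ q : Fin Q, p = simP K m q := by
  obtain ⟨x, ts, h⟩ | ⟨x, ts, h⟩ | ⟨r, hr, rfl | h⟩ := h
  · simp only [sequent, List.mem_cons, List.mem_map, Atom.pred.injEq] at h
    obtain ⟨h, -⟩ | ⟨y, -, h, -⟩ := h
    · exact .inr (.inl h)
    · exact .inl h.symm
  · simp only [sequent, List.mem_singleton, Atom.pred.injEq] at h
    exact .inr (.inr ⟨q₀, h.1⟩)
  · exact (preds_of_mem_rules hr).1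
  · exact (preds_of_mem_rules hr).2 _ h

/-- A predicate with a rule without predicate atoms is productive. -/
theorem productive_mkRule {R : List Rule} {p ps ts ξ} (h : mkRule p ps ts [] ξ ∈ R) :
    Productive R p :=
  .intro (r := mkRule p ps ts [] ξ) h (by simp [mkRule])

/-- If a rule stores all its parameters in its cell, then they are out-going. -/
theorem outParam_mkRule {R : List Rule} {p ps ts calls ξ} (h : mkRule p ps ts calls ξ ∈ R)
    (hts : ∀ i ∈ ps, lv i ∈ ts) {i : ℕ} (hi : 1 ≤ i) (hi' : i < ps.length + 1) :
    OutParam R p i := by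
  obtain ⟨i, rfl⟩ : ∃ j, i = j + 1 := ⟨i - 1, by omega⟩
  have hlt : i < ps.length := by omega
  refine .pointsTo (r := mkRule p ps ts calls ξ) (x := locVar ps[i]) (y := 0) (ts := ts) h ?_ rfl
    (by simp [mkRule]) (hts _ (List.getElem_mem hlt))
  simp [mkRule, Rule.vars, hlt]

theorem tokRule_mem {δ : Fin Q → Fin K → Act Q K} {m : ℕ} : tokRule ∈ rules δ m :=
  mem_rules.2 (.inl rfl)

theorem traceEnd_mem {δ : Fin Q → Fin K → Act Q K} {m : ℕ} : traceEnd K ∈ rules δ m :=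
  mem_rules.2 (.inr (.inl rfl))

theorem traceStep_mem {δ : Fin Q → Fin K → Act Q K} {m : ℕ} (k : Fin K) :
    traceStep K k ∈ rules δ m :=
  mem_rules.2 (.inr (.inr (.inl ⟨k, rfl⟩)))

theorem simEnd_mem {δ : Fin Q → Fin K → Act Q K} {m : ℕ} (q : Fin Q) : simEnd K m q ∈ rules δ m :=
  mem_rules.2 (.inr (.inr (.inr ⟨q, .inl rfl⟩)))

theorem simDump_mem {δ : Fin Q → Fin K → Act Q K} {m : ℕ} (q : Fin Q) :
    simDump K m q ∈ rules δ m :=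
  mem_rules.2 (.inr (.inr (.inr ⟨q, .inr (.inl rfl)⟩)))

theorem actRules_mem {δ : Fin Q → Fin K → Act Q K} {m : ℕ} {r : Rule} {q : Fin Q} {k : Fin K}
    (h : r ∈ actRules m q k (δ q k)) : r ∈ rules δ m :=
  mem_rules.2 (.inr (.inr (.inr ⟨q, .inr (.inr ⟨k, h⟩)⟩)))

theorem productive_sequent {δ : Fin Q → Fin K → Act Q K} {m : ℕ} {q₀ : Fin Q} {L : List (Fin K)}
    {p : PredSym} (h : (sequent δ m q₀ L).HasPred p) : Productive (rules δ m) p := by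
  obtain rfl | rfl | ⟨q, rfl⟩ := hasPred_sequent h
  · exact productive_mkRule tokRule_mem
  · exact productive_mkRule traceEnd_mem
  · exact productive_mkRule (simDump_mem q)

theorem outParam_sequent {δ : Fin Q → Fin K → Act Q K} {m : ℕ} {q₀ : Fin Q} {L : List (Fin K)}
    {p : PredSym} (h : (sequent δ m q₀ L).HasPred p) {i : ℕ} (hi : 1 ≤ i)
    (hp : p.profile[i]? = some .loc) : OutParam (rules δ m) p i := by
  have hlt : i < p.args.length + 1 := by
    simpa [PredSym.profile] using (List.getElem?_eq_some_iff.1 hp).1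
  obtain rfl | rfl | ⟨q, rfl⟩ := hasPred_sequent h
  · simp [tokP] at hlt
    omega
  · refine outParam_mkRule traceEnd_mem ?_ hi (by simpa [traceP] using hlt)
    exact fun i hi => List.mem_cons_of_mem _ (List.mem_map_of_mem hi)
  · refine outParam_mkRule (simDump_mem q) ?_ hi
      (by rw [length_simParams]; simpa [simP] using hlt)
    exact fun i hi => List.mem_cons_of_mem _ (List.mem_map_of_mem hi)

theorem locOnly_lv (i : ℕ) : (lv i).LocOnly := by
  rintro v h
  cases h
  rfl

theorem locOnly_ct (i : ℕ) : (ct i).LocOnly := by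
  rintro v h
  cases h

theorem locOnly_map_lv (l : List ℕ) : ∀ t ∈ l.map lv, t.LocOnly := by
  intro t ht
  obtain ⟨i, -, rfl⟩ := List.mem_map.1 ht
  exact locOnly_lv i

theorem mkRule_locOnly {p ps ts calls ξ} (hts : ∀ t ∈ ts, t.LocOnly)
    (hc : ∀ c ∈ calls, ∀ t ∈ c.2.2, t.LocOnly) (hξ : ∀ a ∈ ξ, a.LocOnly) :
    (mkRule p ps ts calls ξ).LocOnly := by
  refine ⟨?_, ?_, hξ⟩
  · intro v hv
    obtain ⟨i, -, rfl⟩ := List.mem_map.1 hv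
    rfl
  · intro a ha
    simp only [mkRule, List.mem_cons, List.mem_map] at ha
    obtain rfl | ⟨c, hc', rfl⟩ := ha
    · exact hts
    · exact hc c hc'

theorem locOnly_of_mem {δ : Fin Q → Fin K → Act Q K} {m : ℕ} {r : Rule} (hr : r ∈ rules δ m) :
    r.LocOnly := by
  have cell : ∀ (k : ℕ) (l : List ℕ), ∀ t ∈ ct k :: l.map lv, t.LocOnly := fun k l =>
    List.forall_mem_cons.2 ⟨locOnly_ct k, locOnly_map_lv l⟩
  have cell' : ∀ (k z : ℕ) (l : List ℕ), ∀ t ∈ ct k :: (l.map lv ++ [lv z]), t.LocOnly := by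
    intro k z l
    simpa using cell k (l ++ [z])
  have tok : ∀ c ∈ (ys K).map (fun y => (tokP, y, ([] : List Term))), ∀ t ∈ c.2.2, t.LocOnly := by
    intro c hc
    obtain ⟨y, -, rfl⟩ := List.mem_map.1 hc
    simp
  rw [mem_rules] at hr
  obtain rfl | rfl | ⟨k, rfl⟩ | ⟨q, rfl | rfl | ⟨k, hr⟩⟩ := hr
  · exact mkRule_locOnly (by simp) (by simp) (by simp)
  · exact mkRule_locOnly (cell _ _) (by simp) (by simp)
  · refine mkRule_locOnly (cell' _ _ _) ?_ (by simp)
    rw [List.forall_mem_singleton]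
    exact locOnly_map_lv _
  · exact mkRule_locOnly (cell _ _) tok (by simp)
  · exact mkRule_locOnly (cell _ _) (by simp) (by simp)
  · have esc : ∀ ξ : List PureAtom, (∀ a ∈ ξ, a.LocOnly) → (simEscape K m q k ξ).LocOnly :=
      fun ξ hξ => mkRule_locOnly (cell' _ _ _)
        (List.forall_mem_cons.2 ⟨locOnly_map_lv _, tok⟩) hξ
    obtain ⟨-, rfl⟩ | ⟨-, rfl⟩ | ⟨q', k', mv, -, rfl⟩ := mem_actRules hr
    · exact esc _ (by simp)
    · refine esc _ ?_
      rw [List.forall_mem_singleton]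
      exact ⟨locOnly_lv _, locOnly_lv _⟩
    · refine mkRule_locOnly (cell' _ _ _) ?_ (by simp)
      rw [List.forall_mem_singleton]
      exact locOnly_map_lv _

/-- The points-to atom of a rule. -/
theorem pointsTo_mem_mkRule {p ps ts calls ξ y t}
    (h : Atom.pointsTo y t ∈ (mkRule p ps ts calls ξ).body.spatial) : t = ts := by
  simp [mkRule] at h
  exact h.2

theorem eval_ct_inj {I : Interp} {s s' : I.Store} {k k' : ℕ} :
    s.eval (ct k) = s'.eval (ct k') ↔ k = k' := by
  simp only [Interp.Store.eval]
  constructor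
  · intro h
    exact I.const_injective 0 (eq_of_heq (Sigma.mk.inj h).2)
  · rintro rfl
    rfl

theorem simP_inj {m q q' : ℕ} (h : simP K m q = simP K m q') : q = q' := by
  simpa [simP] using h

/-- The cell that is matched by a step shows the symbol under the head, which is excluded by the
disequation of an escape. -/
theorem step_escape_disjoint {I : Interp} {s₁ s₂ : I.Store} {m k : ℕ} {u v : Term} (hk : k < K)
    (hv : (0 :: simParams K m).map (fun i => s₁.eval (lv i)) =
      (0 :: simParams K m).map (fun i => s₂.eval (lv i)))
    (ht : (u :: (((gs K).set k (hd K)).map lv ++ [lv (nx K)])).map s₁.eval =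
      (v :: ((ys K).map lv ++ [lv (nx K)])).map s₂.eval)
    (hne : (mismatch K k).Sat s₂) : False := by
  apply hne
  have h₁ := List.map_inj_left.1 (show
    (0 :: simParams K m).map (fun i => s₁.eval (lv i)) = _ from hv) (hd K)
    (by simp)
  have h₂ := congrArg (·[k + 1]?) ht
  simp [hk, List.getElem?_append] at h₂
  rw [← h₁]
  exact h₂

/-- The constant at the head of the cell of a rule, and what it says about the rule. -/
theorem rule_tag {δ : Fin Q → Fin K → Act Q K} {m : ℕ} {r : Rule} (hr : r ∈ rules δ m)
    {y : ℕ} {t : List Term} (ht : .pointsTo y t ∈ r.body.spatial) :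
    r = tokRule ∨
    (r.head = traceP K ∧ ∃ k l, t = ct k :: l ∧ (k = K ∧ r = traceEnd K ∨
      k < K ∧ r = traceStep K k)) ∨
    ∃ q : Fin Q, r.head = simP K m q ∧ ∃ k l, t = ct k :: l ∧
      (k = K ∧ r = simEnd K m q ∨ k = K + 1 ∧ r = simDump K m q ∨
        ∃ k' : Fin K, k = k' ∧ r ∈ actRules m q k' (δ q k')) := by
  rw [mem_rules] at hr
  obtain rfl | rfl | ⟨k, rfl⟩ | ⟨q, rfl | rfl | ⟨k, hr⟩⟩ := hr
  · exact .inl rfl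
  · exact .inr (.inl ⟨rfl, _, _, pointsTo_mem_mkRule ht, .inl ⟨rfl, rfl⟩⟩)
  · exact .inr (.inl ⟨rfl, _, _, pointsTo_mem_mkRule ht, .inr ⟨k.2, rfl⟩⟩)
  · exact .inr (.inr ⟨q, rfl, _, _, pointsTo_mem_mkRule ht, .inl ⟨rfl, rfl⟩⟩)
  · exact .inr (.inr ⟨q, rfl, _, _, pointsTo_mem_mkRule ht, .inr (.inl ⟨rfl, rfl⟩)⟩)
  · refine .inr (.inr ⟨q, ?_⟩)
    obtain ⟨-, rfl⟩ | ⟨-, rfl⟩ | ⟨q', k', mv, -, rfl⟩ := mem_actRules hr <;>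
    exact ⟨rfl, _, _, pointsTo_mem_mkRule ht, .inr (.inr ⟨k, rfl, hr⟩)⟩

/-- The constant in the cell of a rule, together with the disequation of an escape, determines the
rule among those for the same predicate. -/
theorem deterministic_rules (I : Interp) (δ : Fin Q → Fin K → Act Q K) (m : ℕ) :
    Deterministic I (rules δ m) := by
  have cellEq : ∀ {k k' : ℕ} {l l' : List Term} {s s' : I.Store},
      (ct k :: l).map s.eval = (ct k' :: l').map s'.eval → k = k' := by
    intro k k' l l' s s' h
    rw [List.map_cons, List.map_cons, List.cons.injEq] at h
    exact eval_ct_inj.1 h.1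
  have simTok : ∀ {q}, simP K m q ≠ tokP := by simp [simP, tokP]
  have simTrace : ∀ {q}, simP K m q ≠ traceP K := by simp [simP, traceP]
  have traceTok : traceP K ≠ tokP := by simp [tokP, traceP]
  intro r₁ hr₁ r₂ hr₂ hne hh y₁ y₂ t₁ t₂ ht₁ ht₂
  rintro ⟨s₁, s₂, hvars, hcell, hp₁, hp₂⟩
  obtain rfl | ⟨h₁, k₁, l₁, rfl, e₁⟩ | ⟨q₁, h₁, k₁, l₁, rfl, e₁⟩ := rule_tag hr₁ ht₁ <;>
  obtain rfl | ⟨h₂, k₂, l₂, rfl, e₂⟩ | ⟨q₂, h₂, k₂, l₂, rfl, e₂⟩ := rule_tag hr₂ ht₂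
  · exact hne rfl
  · exact traceTok (h₂.symm.trans hh.symm)
  · exact simTok (h₂.symm.trans hh.symm)
  · exact traceTok (h₁.symm.trans hh)
  · obtain rfl := cellEq hcell
    obtain ⟨h, rfl⟩ | ⟨h, rfl⟩ := e₁ <;> obtain ⟨h', rfl⟩ | ⟨h', rfl⟩ := e₂
    · exact hne rfl
    · omega
    · omega
    · exact hne rfl
  · exact simTrace (h₂.symm.trans (hh.symm.trans h₁))
  · exact simTok (h₁.symm.trans hh)
  · exact simTrace (h₁.symm.trans (hh.trans h₂))
  · obtain rfl := cellEq hcell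
    obtain rfl : q₁ = q₂ := Fin.ext (simP_inj (h₁.symm.trans (hh.trans h₂)))
    obtain ⟨h, rfl⟩ | ⟨h, rfl⟩ | ⟨k, rfl, e₁⟩ := e₁ <;>
    obtain ⟨h', rfl⟩ | ⟨h', rfl⟩ | ⟨k', h', e₂⟩ := e₂
    · exact hne rfl
    · omega
    · omega
    · omega
    · exact hne rfl
    · omega
    · omega
    · omega
    · obtain rfl := Fin.ext h'
      obtain ⟨ha, rfl⟩ | ⟨ha, rfl⟩ | ⟨q', k', mv, ha, rfl⟩ := mem_actRules e₁ <;>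
      obtain ⟨hb, rfl⟩ | ⟨hb, rfl⟩ | ⟨q'', k'', mv', hb, rfl⟩ := mem_actRules e₂
      · exact hne rfl
      · exact hb ha
      · simp [ha] at hb
      · exact ha hb
      · exact hne rfl
      · rw [pointsTo_mem_mkRule ht₁, pointsTo_mem_mkRule ht₂] at hcell
        refine step_escape_disjoint (m := m) k.2 ?_ hcell.symm (hp₁ _ (List.mem_singleton_self _))
        have := hvars.symm
        rwa [show (simEscape K m q₁ k [mismatch K k]).vars = (0 :: simParams K m).map locVar
            from rfl,
          show (simStep K m q₁ k q'' k'' mv').vars = (0 :: simParams K m).map locVar from rfl,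
          List.map_map, List.map_map] at this
      · simp [ha] at hb
      · rw [pointsTo_mem_mkRule ht₁, pointsTo_mem_mkRule ht₂] at hcell
        refine step_escape_disjoint (m := m) k.2 ?_ hcell (hp₂ _ (List.mem_singleton_self _))
        have := hvars
        rwa [show (simEscape K m q₁ k [mismatch K k]).vars = (0 :: simParams K m).map locVar
            from rfl,
          show (simStep K m q₁ k q' k' mv).vars = (0 :: simParams K m).map locVar from rfl,
          List.map_map, List.map_map] at this
      · rw [ha] at hb
        cases hb
        exact hne rfl

/-- The sequent of a rotating machine belongs to the restricted class. -/
theorem sequent_isDetPLoc (I : Interp) (δ : Fin Q → Fin K → Act Q K) {m : ℕ} (q₀ : Fin Q)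
    {L : List (Fin K)} (hL : L.length = m + 2) : (sequent δ m q₀ L).IsDetPLoc I where
  wellSorted := by
    refine ⟨⟨?_, by simp [sequent]⟩, ⟨?_, by simp [sequent]⟩, fun r hr => (isPRule_of_mem hr).1⟩
    · refine List.forall_mem_cons.2 ⟨by simp [Atom.WellSorted, sort_map_lv, traceP, - List.map_map],
        fun a ha => ?_⟩
      obtain ⟨y, -, rfl⟩ := List.mem_map.1 ha
      rfl
    · refine List.forall_mem_singleton.2 ?_
      have : L.map (fun k : Fin K => lv (1 + k)) =
          (L.map fun k : Fin K => 1 + (k : ℕ)).map lv := by simp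
      rw [Atom.WellSorted, this, ← List.map_append, sort_map_lv]
      simp [simP, hL]
  isPRule r hr := isPRule_of_mem hr
  deterministic := deterministic_rules I δ m
  locOnly := by
    refine ⟨⟨?_, by simp [sequent]⟩, ⟨?_, by simp [sequent]⟩, fun r hr => locOnly_of_mem hr⟩
    · refine List.forall_mem_cons.2 ⟨locOnly_map_lv _, fun a ha => ?_⟩
      obtain ⟨y, -, rfl⟩ := List.mem_map.1 ha
      simp [Atom.LocOnly]
    · refine List.forall_mem_singleton.2 fun t ht => ?_
      obtain ht | ht := List.mem_append.1 ht
      · exact locOnly_map_lv _ t ht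
      · obtain ⟨k, -, rfl⟩ := List.mem_map.1 ht
        exact locOnly_lv _
  productive p hp := productive_sequent hp
  noUseless p hp i hi hp' := outParam_sequent hp hi hp'

end SL

/-! ### The sequents can be written in polynomial time -/

namespace StackProg

variable {A α β : Type}

/-- The code of the value of `f` can be written in polynomial time. -/
def EmitsCode (c : BinCode α) (f : List A → α) : Prop := Emits fun w => c.enc (f w)

/-- The code of the list `f w`, except for its end mark, can be written in polynomial time. -/
def EmitsItems (c : BinCode α) (f : List A → List α) : Prop :=
  Emits fun w => (f w).flatMap fun x => true :: c.enc x

theorem EmitsCode.const (c : BinCode α) (x : α) : EmitsCode c fun _ : List A => x :=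
  Emits.const _

theorem EmitsCode.prod {c : BinCode α} {d : BinCode β} {f : List A → α × β}
    (h : EmitsCode c fun w => (f w).1) (h' : EmitsCode d fun w => (f w).2) :
    EmitsCode (c.prod d) f :=
  Emits.append h h'

theorem EmitsCode.inl {c : BinCode α} {d : BinCode β} {f : List A → α} (h : EmitsCode c f) :
    EmitsCode (c.sum d) fun w => .inl (f w) :=
  Emits.append (Emits.const [false]) h

theorem EmitsCode.inr {c : BinCode α} {d : BinCode β} {f : List A → β} (h : EmitsCode d f) :
    EmitsCode (c.sum d) fun w => .inr (f w) :=
  Emits.append (Emits.const [true]) h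

theorem listEnc_eq (c : BinCode α) (l : List α) :
    BinCode.listEnc c l = (l.flatMap fun x => true :: c.enc x) ++ [false] := by
  induction l with
  | nil => rfl
  | cons x l ih => simp [BinCode.listEnc, ih]

theorem EmitsItems.list {c : BinCode α} {f : List A → List α} (h : EmitsItems c f) :
    EmitsCode c.list f := by
  have := Emits.append h (Emits.const [false])
  simpa only [EmitsCode, BinCode.list, listEnc_eq] using this

theorem EmitsItems.nil (c : BinCode α) : EmitsItems c fun _ : List A => [] :=
  Emits.const []

theorem EmitsItems.append {c : BinCode α} {f g : List A → List α} (h : EmitsItems c f)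
    (h' : EmitsItems c g) : EmitsItems c fun w => f w ++ g w := by
  simpa only [EmitsItems, List.flatMap_append] using Emits.append h h'

theorem EmitsItems.singleton {c : BinCode α} {f : List A → α} (h : EmitsCode c f) :
    EmitsItems c fun w => [f w] := by
  simpa [EmitsItems] using Emits.append (Emits.const [true]) h

theorem EmitsItems.cons {c : BinCode α} {f : List A → α} {g : List A → List α}
    (h : EmitsCode c f) (h' : EmitsItems c g) : EmitsItems c fun w => f w :: g w :=
  (EmitsItems.singleton h).append h'

theorem EmitsItems.const (c : BinCode α) (l : List α) : EmitsItems c fun _ : List A => l :=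
  Emits.const _

theorem EmitsItems.flatMap {ι : Type} {c : BinCode α} {f : ι → List A → List α} (l : List ι)
    (h : ∀ i, EmitsItems c (f i)) : EmitsItems c fun w => l.flatMap fun i => f i w := by
  induction l with
  | nil => exact .nil c
  | cons i l ih => exact (h i).append ih

/-- A polynomial number of copies of a constant. -/
theorem EmitsItems.replicate (c : BinCode α) (p : Polynomial ℕ) (x : α) :
    EmitsItems c fun w : List A => List.replicate (p.eval w.length) x := by
  simpa only [EmitsItems, List.flatMap_def, List.map_replicate] using
    Emits.replicate p (true :: c.enc x)

/-- An interval of variables, in a code that contains the index of the variable in unary. -/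
theorem EmitsItems.range' {c : BinCode α} {g : ℕ → α} {l l' : List Bool}
    (hg : ∀ i, c.enc (g i) = l ++ (List.replicate i true ++ l')) (s : ℕ) (p : Polynomial ℕ) :
    EmitsItems c fun w : List A => (List.range' s (p.eval w.length)).map g := by
  have := Emits.range (A := A) p (true :: l ++ List.replicate s true) l'
  simpa only [EmitsItems, List.range'_eq_map_range, List.flatMap_map, Function.comp_def, hg,
    List.cons_append, List.append_assoc, List.replicate_add] using this

end StackProg

namespace SL

open StackProg

variable {A : Type} {Q K : ℕ}

theorem emits_lvs (s : ℕ) (p : Polynomial ℕ) :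
    EmitsItems termCode fun w : List A => (List.range' s (p.eval w.length)).map lv :=
  EmitsItems.range' (l := [false, false]) (l' := [false]) (fun _ => rfl) s p

theorem emits_locVars (s : ℕ) (p : Polynomial ℕ) :
    EmitsItems varCode fun w : List A => (List.range' s (p.eval w.length)).map locVar :=
  EmitsItems.range' (l := [false]) (l' := [false]) (fun _ => rfl) s p

theorem emits_pred {p : List A → PredSym} {x : ℕ} {ts : List A → List Term}
    (hp : EmitsCode predSymCode p) (hts : EmitsItems termCode ts) :
    EmitsCode atomCode fun w => .pred (p w) x (ts w) :=
  EmitsCode.inr (c := BinCode.nat.prod termCode.list) (f := fun w => (p w, x, ts w))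
     (hp.prod (.prod (.const _ x) hts.list))

theorem emits_pointsTo {x : ℕ} {ts : List A → List Term} (hts : EmitsItems termCode ts) :
    EmitsCode atomCode fun w => .pointsTo x (ts w) :=
  EmitsCode.inl (d := predSymCode.prod (BinCode.nat.prod termCode.list))
    (f := fun w => (x, ts w)) (.prod (.const _ x) hts.list)

theorem emits_symHeap {sp : List A → List Atom} {ξ : List PureAtom}
    (hsp : EmitsItems atomCode sp) :
    EmitsCode symHeapCode fun w => ⟨sp w, ξ⟩ :=
  EmitsCode.prod (f := fun w => (sp w, ξ)) hsp.list (.const _ ξ)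

theorem emits_mkRule {p : List A → PredSym} {ps : List A → List ℕ} {ts : List A → List Term}
    {calls : List A → List (PredSym × ℕ × List Term)} {ξ : List PureAtom}
    (hp : EmitsCode predSymCode p) (hps : EmitsItems varCode fun w => (ps w).map locVar)
    (hts : EmitsItems termCode ts)
    (hc : EmitsItems atomCode fun w => (calls w).map fun c => .pred c.1 c.2.1 c.2.2) :
    EmitsCode ruleCode fun w => mkRule (p w) (ps w) (ts w) (calls w) ξ :=
  EmitsCode.prod (f := fun w =>
      (p w, 0, (ps w).map locVar, (mkRule (p w) (ps w) (ts w) (calls w) ξ).body))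
    hp (.prod (.const _ 0) (.prod hps.list (emits_symHeap (.cons (emits_pointsTo hts) hc))))

section

variable (p : Polynomial ℕ)

theorem emits_simP (q : ℕ) :
    EmitsCode predSymCode fun w : List A => simP K (p.eval w.length) q := by
  refine EmitsCode.prod
    (f := fun w : List A => (q + 2, List.replicate (K + (p.eval w.length + 2)) Srt.loc))
    (.const _ _) ?_
  have : EmitsItems srtCode fun w : List A =>
      List.replicate (p.eval w.length) Srt.loc ++ List.replicate (K + 2) .loc :=
    .append (.replicate _ p _) (.const _ _)
  simp only [List.replicate_append_replicate] at this
  have h : EmitsCode srtCode.list fun w : List A =>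
      List.replicate (p.eval w.length + (K + 2)) Srt.loc := this.list
  simpa only [Nat.add_left_comm K] using h

theorem emits_simParams :
    EmitsItems varCode fun w : List A => (simParams K (p.eval w.length)).map locVar := by
  simp only [simParams, List.map_append, List.map_cons]
  exact .append (.const _ _) (.cons (.const _ _) (.append (emits_locVars _ p) (.const _ _)))

theorem emits_rot (mv : Complexity.Move) (k l : ℕ) :
    EmitsItems termCode fun w : List A => (rot mv k (mid K (p.eval w.length)) l).map lv := by
  cases mv
  · exact .cons (.const _ _) (.cons (.const _ _) (emits_lvs _ p))
  · simp only [rot, List.map_append, List.map_cons]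
    exact .cons (.const _ _) (.append (emits_lvs _ p) (.const _ _))
  · simp only [rot, List.map_append]
    exact .append (emits_lvs _ p) (.const _ _)

theorem emits_simEscape (q k : ℕ) (ξ : List PureAtom) :
    EmitsCode ruleCode fun w : List A => simEscape K (p.eval w.length) q k ξ :=
  emits_mkRule (emits_simP p q) (emits_simParams p) (.const _ _) (.const _ _)

theorem emits_actRules (q k : ℕ) (a : Act Q K) :
    EmitsItems ruleCode fun w : List A => actRules (p.eval w.length) q k a := by
  cases a with
  | acc => exact .singleton (emits_simEscape p q k _)
  | rej => exact .singleton (emits_simEscape p q k _)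
  | go q' k' mv =>
    refine .cons (emits_simEscape p q k _) (.singleton ?_)
    refine emits_mkRule (emits_simP p q) (emits_simParams p) (.const _ _) (.singleton ?_)
    refine emits_pred (emits_simP p q') ?_
    simp only [List.map_append]
    exact .append (.const _ _) (emits_rot p _ _ _)

theorem emits_rules (δ : Fin Q → Fin K → Act Q K) :
    EmitsItems ruleCode fun w : List A => rules δ (p.eval w.length) := by
  refine .cons (.const _ _) (.cons (.const _ _) (.append (.const _ _) (.flatMap _ fun q => ?_)))
  refine .cons ?_ (.cons ?_ (.flatMap _ fun k => emits_actRules p q k _))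
  · exact emits_mkRule (emits_simP p q) (emits_simParams p) (.const _ _) (.const _ _)
  · refine emits_mkRule (emits_simP p q) (emits_simParams p) (.cons (.const _ _) ?_) (.const _ _)
    simp only [simParams, List.map_append, List.map_cons]
    exact .append (.const _ _) (.cons (.const _ _) (.append (emits_lvs _ p) (.const _ _)))

/-- The sequent of a rotating machine is computable in polynomial time from the word `w` if its
tape consists of the image of `w`, a polynomial number of copies of a symbol, and a last symbol. -/
theorem emits_sequent [Finite A] (p' : Polynomial ℕ) (δ : Fin Q → Fin K → Act Q K) (q₀ : Fin Q)
    (g : A → Fin K) (b l : Fin K) :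
    EmitsCode sequentCode fun w : List A =>
      sequent δ (p.eval w.length) q₀ (w.map g ++ (List.replicate (p'.eval w.length) b ++ [l])) := by
  refine EmitsCode.prod (f := fun w : List A =>
    let S := sequent δ (p.eval w.length) q₀
      (w.map g ++ (List.replicate (p'.eval w.length) b ++ [l]))
    (S.lhs, S.rhs, S.rules)) (.const _ _) (.prod ?_ (emits_rules p δ).list)
  refine emits_symHeap (.singleton (emits_pred (emits_simP p q₀) ?_))
  refine .append (.const _ _) ?_
  simp only [List.map_append, List.map_map, List.map_replicate]
  refine .append ?_ (.append (.replicate _ p' _) (.const _ _))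
  unfold EmitsItems
  simp only [List.flatMap_map]
  exact Emits.flatMap _

end

end SL

/-! ### Models of separating conjunctions -/

namespace SL

variable {I : Interp}

/-- The universe element given by a location. -/
def lval (u : I.U .loc) : I.Val := ⟨.loc, u⟩

theorem lval_injective : Function.Injective (lval (I := I)) := fun _ _ h =>
  eq_of_heq (Sigma.mk.inj h).2

/-- The value of the constant `ct i`. -/
def cval (I : Interp) (i : ℕ) : I.Val := ⟨.data 0, I.const 0 i⟩

theorem cval_injective : Function.Injective (cval I) := fun _ _ h =>
  I.const_injective 0 (eq_of_heq (Sigma.mk.inj h).2)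

theorem eval_lv (s : I.Store) (i : ℕ) : s.eval (lv i) = lval (s (locVar i)) := rfl

theorem eval_ct (s : I.Store) (i : ℕ) : s.eval (ct i) = cval I i := rfl

/-- The values of location variables. -/
def vals (s : I.Store) (l : List ℕ) : List (I.U .loc) := l.map fun i => s (locVar i)

theorem map_eval_lv (s : I.Store) (l : List ℕ) :
    (l.map lv).map s.eval = (vals s l).map lval := by
  simp [vals, eval_lv]

namespace Interp.Heap

theorem ext {h h' : I.Heap} (H : ∀ l, h.map l = h'.map l) : h = h' := by
  obtain ⟨f, hf⟩ := h
  obtain ⟨g, hg⟩ := h'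
  obtain rfl : f = g := funext H
  rfl

/-- The empty heap. -/
def empty : I.Heap := ⟨fun _ => none, by simp⟩

/-- The union of two heaps; the first one takes precedence. -/
def union (h₁ h₂ : I.Heap) : I.Heap where
  map l := (h₁.map l).or (h₂.map l)
  finite_dom := (h₁.finite_dom.union h₂.finite_dom).subset fun l hl => by
    by_contra hc
    simp only [Set.mem_union, Set.mem_ofPred_eq, not_or, not_not] at hc
    simp [hc.1, hc.2] at hl

open Classical in
/-- The heap with a single cell. -/
noncomputable def single (l : I.U .loc) (v : List I.Val) : I.Heap where
  map k := if k = l then some v else none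
  finite_dom := (Set.finite_singleton l).subset fun k hk => by
    by_contra hc
    simp only [Set.mem_singleton_iff] at hc
    simp [hc] at hk

theorem isSingleton_single (l : I.U .loc) (v : List I.Val) : (single l v).IsSingleton l v :=
  ⟨by simp [single], fun k hk => by simp [single, hk]⟩

theorem isDisjointUnion_empty (h : I.Heap) : h.IsDisjointUnion h empty :=
  ⟨fun _ => .inr rfl, fun l => by simp [empty]⟩

theorem IsDisjointUnion.eq_of_isEmpty {h h₁ h₂ : I.Heap} (H : h.IsDisjointUnion h₁ h₂)
    (he : h₂.IsEmpty) : h = h₁ :=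
  ext fun l => by rw [H.2, he l, Option.or_none]

theorem IsDisjointUnion.assoc {h a b c d : I.Heap} (H : h.IsDisjointUnion a b)
    (H' : a.IsDisjointUnion c d) :
    ∃ e : I.Heap, h.IsDisjointUnion c e ∧ e.IsDisjointUnion d b := by
  have key : ∀ l, d.map l = none ∨ b.map l = none := by
    intro l
    rcases H.1 l with h | h
    · rw [H'.2] at h
      exact .inl (Option.or_eq_none_iff.1 h).2
    · exact .inr h
  refine ⟨union d b, ⟨fun l => ?_, fun l => ?_⟩, key, fun l => rfl⟩
  · rcases H'.1 l with h | h
    · exact .inl h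
    · rcases H.1 l with h' | h'
      · rw [H'.2] at h'
        exact .inl (Option.or_eq_none_iff.1 h').1
      · exact .inr (by simp [union, h, h'])
  · rw [H.2, H'.2, Option.or_assoc]
    rfl

theorem IsDisjointUnion.map_left {h a b : I.Heap} (H : h.IsDisjointUnion a b) {l : I.U .loc}
    {v : List I.Val} (hl : a.map l = some v) : h.map l = some v := by
  rw [H.2, hl, Option.some_or]

theorem IsDisjointUnion.map_right {h a b : I.Heap} (H : h.IsDisjointUnion a b) {l : I.U .loc}
    {v : List I.Val} (hl : b.map l = some v) : h.map l = some v := by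
  rcases H.1 l with h' | h'
  · rw [H.2, h', hl, Option.none_or]
  · rw [h'] at hl; cases hl

end Interp.Heap

/-- Satisfaction of a separating conjunction when the predicates are interpreted by `J`. -/
def ListSat (J : PredSym → List I.Val → I.Heap → Prop) (s : I.Store) : I.Heap → List Atom → Prop
  | h, [] => h.IsEmpty
  | h, .pointsTo x ts :: φ => ∃ h₁ h₂ : I.Heap, h.IsDisjointUnion h₁ h₂ ∧
      h₁.IsSingleton (s (locVar x)) (ts.map s.eval) ∧ ListSat J s h₂ φ
  | h, .pred p x ts :: φ => ∃ h₁ h₂ : I.Heap, h.IsDisjointUnion h₁ h₂ ∧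
      J p ((lv x :: ts).map s.eval) h₁ ∧ ListSat J s h₂ φ

/-- The interpretation of the predicates by the least fixed point of the rules. -/
def PredSat (R : List Rule) (p : PredSym) (vs : List I.Val) (h : I.Heap) : Prop :=
  ∃ r ∈ R, r.head = p ∧ ∃ s : I.Store, r.vars.map (fun v => s.eval (.var v)) = vs ∧
    (∀ a ∈ r.body.pure, a.Sat s) ∧ SatSpatial R s h r.body.spatial

theorem satSpatial_iff {R : List Rule} {s : I.Store} {h : I.Heap} {φ : List Atom} :
    SatSpatial R s h φ ↔ ListSat (PredSat R) s h φ := by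
  constructor
  · intro H
    induction H with
    | emp h => exact h
    | pointsTo hu hs _ ih => exact ⟨_, _, hu, hs, ih⟩
    | pred hu hr hv hp hb _ _ ih => exact ⟨_, _, hu, ⟨_, hr, rfl, _, hv, hp, hb⟩, ih⟩
  · induction φ generalizing h with
    | nil => exact .emp
    | cons a φ ih =>
      cases a with
      | pointsTo x ts => exact fun ⟨h₁, h₂, hu, hs, hφ⟩ => .pointsTo hu hs (ih hφ)
      | pred p x ts =>
        rintro ⟨h₁, h₂, hu, ⟨r, hr, rfl, s₁, hv, hp, hb⟩, hφ⟩
        exact .pred hu hr hv hp hb (ih hφ)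

/-- The least fixed point lies below every interpretation that is closed under the rules. -/
theorem PredSat.of_closed {R : List Rule} {J : PredSym → List I.Val → I.Heap → Prop}
    (hJ : ∀ r ∈ R, ∀ (s : I.Store) (h : I.Heap), ListSat J s h r.body.spatial →
      J r.head (r.vars.map fun v => s.eval (.var v)) h)
    {p : PredSym} {vs : List I.Val} {h : I.Heap} (H : PredSat R p vs h) : J p vs h := by
  have key : ∀ {s : I.Store} {h : I.Heap} {φ : List Atom}, SatSpatial R s h φ →
      ListSat J s h φ := by
    intro s h φ H
    induction H with
    | emp h => exact h
    | pointsTo hu hs _ ih => exact ⟨_, _, hu, hs, ih⟩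
    | pred hu hr hv _ _ _ ih₁ ih₂ => exact ⟨_, _, hu, hv ▸ hJ _ hr _ _ ih₁, ih₂⟩
  obtain ⟨r, hr, rfl, s, rfl, -, hb⟩ := H
  exact hJ r hr s h (key hb)

theorem listSat_singleton {J : PredSym → List I.Val → I.Heap → Prop} {s : I.Store} {h : I.Heap}
    {p : PredSym} {x : ℕ} {ts : List Term} :
    ListSat J s h [.pred p x ts] ↔ J p ((lv x :: ts).map s.eval) h := by
  constructor
  · rintro ⟨h₁, h₂, hu, hJ, he⟩
    rwa [hu.eq_of_isEmpty he]
  · exact fun hJ => ⟨h, .empty, h.isDisjointUnion_empty, hJ, fun _ => rfl⟩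

theorem mkRule_vars_eval (s : I.Store) {p ps ts calls ξ} :
    (mkRule p ps ts calls ξ).vars.map (fun v => s.eval (.var v)) = (vals s (0 :: ps)).map lval := by
  simp [mkRule, Rule.vars, vals, eval_lv]

theorem predSat_of_mkRule {R : List Rule} {p ps ts calls ξ} (hr : mkRule p ps ts calls ξ ∈ R)
    {s : I.Store} {h h₁ h₂ : I.Heap} {us : List (I.U .loc)} (hv : vals s (0 :: ps) = us)
    (hξ : ∀ a ∈ ξ, a.Sat s) (hu : h.IsDisjointUnion h₁ h₂)
    (h₁s : h₁.IsSingleton (s (locVar 0)) (ts.map s.eval))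
    (hc : ListSat (PredSat R) s h₂ (calls.map fun c => .pred c.1 c.2.1 c.2.2)) :
    PredSat R p (us.map lval) h :=
  ⟨_, hr, rfl, s, by rw [mkRule_vars_eval, hv], hξ, satSpatial_iff.2 ⟨h₁, h₂, hu, h₁s, hc⟩⟩

/-- The store with the given values of the location variables. -/
noncomputable def storeOf (F : ℕ → I.U .loc) : I.Store
  | ⟨.loc, i⟩ => F i
  | ⟨.data d, _⟩ => I.const d 0

theorem vals_storeOf (F : ℕ → I.U .loc) (l : List ℕ) : vals (storeOf F) l = l.map F := rfl

/-- The values of the variables of a rule, listed in the order of their indices. -/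
noncomputable def ruleStore (x : I.U .loc) (gv yv : List (I.U .loc)) (a e z : I.U .loc)
    (bv : List (I.U .loc)) : I.Store :=
  storeOf fun i => (([x] ++ gv ++ yv ++ [a, e, z] ++ bv)[i]?).getD x

theorem map_range'_getD {α : Type} (l₁ l₂ l₃ : List α) (d : α) {s n : ℕ} (hs : s = l₁.length)
    (hn : n = l₂.length) :
    (List.range' s n).map (fun i => ((l₁ ++ l₂ ++ l₃)[i]?).getD d) = l₂ := by
  subst hs hn
  refine List.ext_getElem (by simp) fun i h₁ h₂ => ?_
  simp [List.getElem?_append, h₂]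

section ruleStore

variable {K m : ℕ} {x a e z : I.U .loc} {gv yv bv : List (I.U .loc)}
  (hg : gv.length = K) (hy : yv.length = K)

include hg in
theorem vals_gs : vals (ruleStore x gv yv a e z bv) (gs K) = gv := by
  have := map_range'_getD [x] gv (yv ++ [a, e, z] ++ bv) x rfl hg.symm
  simpa [ruleStore, vals_storeOf] using this

include hg hy in
theorem vals_ys : vals (ruleStore x gv yv a e z bv) (ys K) = yv := by
  have := map_range'_getD ([x] ++ gv) yv ([a, e, z] ++ bv) x (s := K + 1) (by simp [hg]) hy.symm
  simpa [ruleStore, vals_storeOf] using this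

include hg hy in
theorem vals_cells : vals (ruleStore x gv yv a e z bv) [hd K, lst K, nx K] = [a, e, z] := by
  have := map_range'_getD ([x] ++ gv ++ yv) [a, e, z] bv x (s := 2 * K + 1) (n := 3)
    (by simp [hg, hy]; omega) rfl
  simpa [ruleStore, vals_storeOf, List.range'] using this

include hg hy in
theorem vals_mid (hb : bv.length = m) :
    vals (ruleStore x gv yv a e z bv) (mid K m) = bv := by
  have := map_range'_getD ([x] ++ gv ++ yv ++ [a, e, z]) bv [] x (s := 2 * K + 4)
    (by simp [hg, hy]; omega) hb.symm
  simpa [ruleStore, vals_storeOf] using this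

theorem ruleStore_zero : ruleStore x gv yv a e z bv (locVar 0) = x := by
  simp [ruleStore, storeOf]

end ruleStore

/-! ### Traces -/

variable {Q K : ℕ}

/-- `Trace G x ks h`: the heap `h` is a list that starts at `x` and whose cells show the symbols
`ks`; the symbols stand for the locations `G`. -/
inductive Trace (G : Fin K → I.U .loc) : I.U .loc → List (Fin K) → I.Heap → Prop
  | nil {x h} : h.IsSingleton x (cval I K :: (List.ofFn G).map lval) → Trace G x [] h
  | cons {x z h h₁ h₂ k ks} : h.IsDisjointUnion h₁ h₂ →
      h₁.IsSingleton x (cval I k :: ((List.ofFn G).map lval ++ [lval z])) → Trace G z ks h₂ →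
      Trace G x (k :: ks) h

/-- The heap consists of one cell with an empty tuple for each of the locations. -/
def Toks : List (I.U .loc) → I.Heap → Prop
  | [], h => h.IsEmpty
  | v :: vs, h => ∃ h₁ h₂ : I.Heap, h.IsDisjointUnion h₁ h₂ ∧ h₁.IsSingleton v [] ∧ Toks vs h₂

theorem Toks.nodup {vs : List (I.U .loc)} {h : I.Heap} (H : Toks vs h) :
    vs.Nodup ∧ ∀ v ∈ vs, h.map v ≠ none := by
  induction vs generalizing h with
  | nil => simp
  | cons v vs ih =>
    obtain ⟨h₁, h₂, hu, h₁s, hvs⟩ := H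
    obtain ⟨hnd, hdom⟩ := ih hvs
    refine ⟨List.nodup_cons.2 ⟨fun hv => ?_, hnd⟩, ?_⟩
    · rcases hu.1 v with h | h
      · rw [h₁s.1] at h; cases h
      · exact hdom v hv h
    · rw [List.forall_mem_cons]
      refine ⟨by rw [hu.map_left h₁s.1]; simp, fun u hu' => ?_⟩
      obtain ⟨w, hw⟩ := Option.ne_none_iff_exists'.1 (hdom u hu')
      rw [hu.map_right hw]
      simp

variable {δ : Fin Q → Fin K → Act Q K} {m : ℕ}

theorem rule_of_head_tokP {r : Rule} (hr : r ∈ rules δ m) (h : r.head = tokP) : r = tokRule := by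
  rw [mem_rules] at hr
  obtain rfl | rfl | ⟨k, rfl⟩ | ⟨q, rfl | rfl | ⟨k, hr⟩⟩ := hr
  · rfl
  · cases h
  · cases h
  · cases h
  · cases h
  · obtain ⟨-, rfl⟩ | ⟨-, rfl⟩ | ⟨q', k', mv, -, rfl⟩ := mem_actRules hr <;> cases h

theorem rule_of_head_traceP {r : Rule} (hr : r ∈ rules δ m) (h : r.head = traceP K) :
    r = traceEnd K ∨ ∃ k : Fin K, r = traceStep K k := by
  rw [mem_rules] at hr
  have ne : ∀ q, simP K m q ≠ traceP K := by simp [simP, traceP]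
  obtain rfl | rfl | hr | ⟨q, rfl | rfl | ⟨k, hr⟩⟩ := hr
  · cases h
  · exact .inl rfl
  · exact .inr hr
  · exact absurd h (ne _)
  · exact absurd h (ne _)
  · obtain ⟨-, rfl⟩ | ⟨-, rfl⟩ | ⟨q', k', mv, -, rfl⟩ := mem_actRules hr <;> exact absurd h (ne _)

theorem rule_of_head_simP {r : Rule} {q : Fin Q} (hr : r ∈ rules δ m) (h : r.head = simP K m q) :
    r = simEnd K m q ∨ r = simDump K m q ∨ ∃ k : Fin K, r ∈ actRules m q k (δ q k) := by
  rw [mem_rules] at hr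
  have ne : ∀ {q}, traceP K ≠ simP K m q := by simp [simP, traceP]
  obtain rfl | rfl | ⟨k, rfl⟩ | ⟨q', hr⟩ := hr
  · cases h
  · exact absurd h ne
  · exact absurd h ne
  · have : r.head = simP K m q' := by
      obtain rfl | rfl | ⟨k, hr⟩ := hr
      · rfl
      · rfl
      · obtain ⟨-, rfl⟩ | ⟨-, rfl⟩ | ⟨q', k', mv, -, rfl⟩ := mem_actRules hr <;> rfl
    obtain rfl : q' = q := Fin.ext (simP_inj (this.symm.trans h))
    exact hr

theorem predSat_tokP {v : I.U .loc} {h : I.Heap} :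
    PredSat (rules δ m) tokP [lval v] h ↔ h.IsSingleton v [] := by
  constructor
  · rintro ⟨r, hr, hh, s, hv, -, hb⟩
    obtain rfl := rule_of_head_tokP hr hh
    obtain ⟨h₁, h₂, hu, h₁s, he⟩ := satSpatial_iff.1 hb
    rw [hu.eq_of_isEmpty he]
    have : s (locVar 0) = v := lval_injective (List.cons.inj hv).1
    rwa [this] at h₁s
  · intro H
    have hv : vals (storeOf fun _ => v) (0 :: []) = [v] := rfl
    exact predSat_of_mkRule (us := [v]) tokRule_mem hv (by simp) h.isDisjointUnion_empty H
      fun _ => rfl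

theorem listSat_toks {s : I.Store} {h : I.Heap} {l : List ℕ} :
    ListSat (PredSat (rules δ m)) s h (l.map fun i => .pred tokP i []) ↔ Toks (vals s l) h := by
  induction l generalizing h with
  | nil => exact Iff.rfl
  | cons i l ih =>
    refine exists_congr fun h₁ => exists_congr fun h₂ => and_congr_right fun _ => and_congr ?_ ih
    exact predSat_tokP

theorem trace_of_predSat {G : Fin K → I.U .loc} {x : I.U .loc} {h : I.Heap}
    (H : PredSat (rules δ m) (traceP K) ((x :: List.ofFn G).map lval) h) :
    ∃ ks, Trace G x ks h := by
  refine PredSat.of_closed (J := fun p vs h => p = traceP K → ∀ x (G : Fin K → I.U .loc),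
    vs = (x :: List.ofFn G).map lval → ∃ ks, Trace G x ks h) ?_ H rfl x G rfl
  clear H
  intro r hr s h hb hp x G hv
  obtain rfl | ⟨k, rfl⟩ := rule_of_head_traceP hr hp
  · rw [traceEnd, mkRule_vars_eval] at hv
    obtain ⟨hx, hg⟩ := List.cons.inj (lval_injective.list_map hv)
    obtain ⟨h₁, h₂, hu, h₁s, he⟩ := hb
    change vals s (gs K) = _ at hg
    change s (locVar 0) = x at hx
    rw [hx, List.map_cons, map_eval_lv, hg] at h₁s
    rw [hu.eq_of_isEmpty he]
    exact ⟨[], .nil h₁s⟩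
  · rw [traceStep, mkRule_vars_eval] at hv
    obtain ⟨hx, hg⟩ := List.cons.inj (lval_injective.list_map hv)
    obtain ⟨h₁, h₂, hu, h₁s, hc⟩ := hb
    change vals s (gs K) = _ at hg
    change s (locVar 0) = x at hx
    rw [hx, List.map_cons, List.map_append, map_eval_lv, hg] at h₁s
    obtain ⟨ks, ht⟩ := listSat_singleton.1 hc rfl (s (locVar (nx K))) G (by
      rw [List.map_cons, map_eval_lv, hg]; rfl)
    exact ⟨k :: ks, .cons hu h₁s ht⟩

theorem Trace.predSat {G : Fin K → I.U .loc} {x : I.U .loc} {ks : List (Fin K)} {h : I.Heap}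
    (H : Trace G x ks h) :
    PredSat (rules δ m) (traceP K) ((x :: List.ofFn G).map lval) h := by
  induction H with
  | @nil x h hs =>
    have hg := vals_gs (K := K) (x := x) (gv := List.ofFn G) (yv := List.ofFn G) (a := x) (e := x)
      (z := x) (bv := []) (by simp)
    refine predSat_of_mkRule traceEnd_mem
      (s := ruleStore x (List.ofFn G) (List.ofFn G) x x x []) ?_ (by simp)
      h.isDisjointUnion_empty ?_ fun _ => rfl
    · exact congrArg₂ List.cons ruleStore_zero hg
    · rwa [ruleStore_zero, List.map_cons, map_eval_lv, hg]
  | @cons x z h h₁ h₂ k ks hu hs _ ih =>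
    have hg := vals_gs (K := K) (x := x) (gv := List.ofFn G) (yv := List.ofFn G) (a := x) (e := x)
      (z := z) (bv := []) (by simp)
    have hc := vals_cells (K := K) (x := x) (gv := List.ofFn G) (yv := List.ofFn G) (a := x)
      (e := x) (z := z) (bv := []) (by simp) (by simp)
    simp only [vals, List.map_cons, List.map_nil, List.cons.injEq, and_true] at hc
    refine predSat_of_mkRule (traceStep_mem k)
      (s := ruleStore x (List.ofFn G) (List.ofFn G) x x z []) ?_ (by simp) hu ?_ ?_
    · exact congrArg₂ List.cons ruleStore_zero hg
    · rw [ruleStore_zero, List.map_cons, List.map_append, map_eval_lv, hg]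
      simpa [eval_lv, eval_ct, hc.2.2] using hs
    · refine listSat_singleton.2 ?_
      rw [List.map_cons, map_eval_lv, hg, eval_lv, hc.2.2]
      exact ih

end SL

/-! ### Validity and the runs of a rotating machine -/

namespace SL

variable {I : Interp} {Q K : ℕ}

/-- The machine accepts from the state `q` with the cyclic tape `L`, the head being on the first
cell. -/
inductive Accepts (δ : Fin Q → Fin K → Act Q K) : Fin Q → List (Fin K) → Prop
  | acc {q c B l} : δ q c = .acc → Accepts δ q (c :: (B ++ [l]))
  | go {q c B l q' c' mv} : δ q c = .go q' c' mv → Accepts δ q' (rot mv c' B l) →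
      Accepts δ q (c :: (B ++ [l]))

/-- The machine rejects from the state `q` with the cyclic tape `L`, having read the symbols
`ks`. -/
inductive Rejects (δ : Fin Q → Fin K → Act Q K) : Fin Q → List (Fin K) → List (Fin K) → Prop
  | rej {q c B l} : δ q c = .rej → Rejects δ q (c :: (B ++ [l])) [c]
  | go {q c B l q' c' mv ks} : δ q c = .go q' c' mv → Rejects δ q' (rot mv c' B l) ks →
      Rejects δ q (c :: (B ++ [l])) (c :: ks)

variable {δ : Fin Q → Fin K → Act Q K} {m : ℕ}

theorem vals_append (s : I.Store) (l l' : List ℕ) : vals s (l ++ l') = vals s l ++ vals s l' :=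
  List.map_append

theorem vals_cons (s : I.Store) (i : ℕ) (l : List ℕ) :
    vals s (i :: l) = s (locVar i) :: vals s l := rfl

theorem vals_set (s : I.Store) (l : List ℕ) (i j : ℕ) :
    vals s (l.set i j) = (vals s l).set i (s (locVar j)) := List.map_set

theorem vals_rot (s : I.Store) (mv : Complexity.Move) (c : ℕ) (B : List ℕ) (l : ℕ) :
    vals s (rot mv c B l) = rot mv (s (locVar c)) (vals s B) (s (locVar l)) :=
  map_rot _ ..

theorem vals_range' (s : I.Store) (a n : ℕ) :
    vals s (List.range' a n) = List.ofFn fun k : Fin n => s (locVar (a + k)) := by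
  let f : ℕ → I.U .loc := fun i => s (locVar i)
  change (List.range' a n).map f = List.ofFn fun k : Fin n => f (a + k)
  clear_value f
  exact List.ext_getElem (by simp) fun i h₁ h₂ => by simp

theorem of_vals_gs {s : I.Store} {G : Fin K → I.U .loc} (hg : vals s (gs K) = List.ofFn G)
    (k : Fin K) : s (locVar (1 + k)) = G k :=
  congrFun (List.ofFn_injective ((vals_range' s 1 K).symm.trans hg)) k

theorem of_vals_ys {s : I.Store} {G : Fin K → I.U .loc} (hg : vals s (ys K) = List.ofFn G)
    (k : Fin K) : s (locVar (K + 1 + k)) = G k :=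
  congrFun (List.ofFn_injective ((vals_range' s (K + 1) K).symm.trans hg)) k

/-- The store that assigns to the variables of a simulation rule their values in a configuration
with the cyclic tape `c :: B ++ [l]`, where `z` is the next cell of the trace. -/
noncomputable def cfgStore (G : Fin K → I.U .loc) (x z : I.U .loc) (c : Fin K) (B : List (Fin K))
    (l : Fin K) : I.Store :=
  ruleStore x (List.ofFn G) (List.ofFn G) (G c) (G l) z (B.map G)

section cfgStore

variable (G : Fin K → I.U .loc) (x z : I.U .loc) (c : Fin K) {B : List (Fin K)} (l : Fin K)

theorem cfgStore_zero : cfgStore G x z c B l (locVar 0) = x := ruleStore_zero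

theorem cfgStore_gs : vals (cfgStore G x z c B l) (gs K) = List.ofFn G := vals_gs (by simp)

theorem cfgStore_ys : vals (cfgStore G x z c B l) (ys K) = List.ofFn G :=
  vals_ys (by simp) (by simp)

theorem cfgStore_cells : cfgStore G x z c B l (locVar (hd K)) = G c ∧
    cfgStore G x z c B l (locVar (lst K)) = G l ∧ cfgStore G x z c B l (locVar (nx K)) = z := by
  have := vals_cells (K := K) (x := x) (gv := List.ofFn G) (yv := List.ofFn G) (a := G c)
      (e := G l) (z := z) (bv := B.map G) (by simp) (by simp)
  simpa [vals, cfgStore] using this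

theorem cfgStore_params (hB : B.length = m) :
    vals (cfgStore G x z c B l) (0 :: simParams K m) =
      x :: (List.ofFn G ++ (c :: (B ++ [l])).map G) := by
  rw [vals_cons, vals_append, vals_cons, vals_append, vals_cons, cfgStore_gs, cfgStore_zero,
    (cfgStore_cells G x z c l).1, (cfgStore_cells G x z c l).2.1, cfgStore,
    vals_mid (m := m) (by simp) (by simp) (by simpa using hB)]
  simp [vals]

end cfgStore

theorem toks_calls {s : I.Store} {h : I.Heap} {l : List ℕ} :
    ListSat (PredSat (rules δ m)) s h
      ((l.map fun y => (tokP, y, ([] : List Term))).map fun c => .pred c.1 c.2.1 c.2.2) ↔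
      Toks (vals s l) h := by
  rw [List.map_map]
  exact listSat_toks

/-- An escape is possible whenever its disequations hold. -/
theorem predSat_of_escape {G : Fin K → I.U .loc} {x z : I.U .loc} {ks : List (Fin K)}
    {h h₁ h₂ h₃ h₄ : I.Heap} {q : Fin Q} {k c l : Fin K} {B : List (Fin K)} {ξ : List PureAtom}
    (hr : simEscape K m q k ξ ∈ rules δ m) (hB : B.length = m)
    (hξ : ∀ a ∈ ξ, a.Sat (cfgStore G x z c B l))
    (hu : h.IsDisjointUnion h₁ h₂)
    (hs : h₁.IsSingleton x (cval I k :: ((List.ofFn G).map lval ++ [lval z])))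
    (hu' : h₂.IsDisjointUnion h₃ h₄) (ht : Trace G z ks h₃) (hk : Toks (List.ofFn G) h₄) :
    PredSat (rules δ m) (simP K m q)
      ((x :: (List.ofFn G ++ (c :: (B ++ [l])).map G)).map lval) h := by
  have hy := cfgStore_ys G x z c (B := B) l
  have hz := (cfgStore_cells G x z c (B := B) l).2.2
  refine predSat_of_mkRule hr (cfgStore_params G x z c l hB) hξ hu ?_ ⟨h₃, h₄, hu', ?_, ?_⟩
  · rw [cfgStore_zero, List.map_cons, List.map_append, map_eval_lv, hy, List.map_singleton,
      eval_lv, hz]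
    exact hs
  · rw [List.map_cons, map_eval_lv, hy, eval_lv, hz]
    exact ht.predSat
  · rw [toks_calls, hy]
    exact hk

/-- If the machine accepts, then every trace makes the simulation succeed: it either follows the
run, or it can escape at the first wrong symbol. -/
theorem Accepts.predSat {G : Fin K → I.U .loc} (hG : Function.Injective G) {ks : List (Fin K)}
    {x : I.U .loc} {h h₁ h₂ : I.Heap} (ht : Trace G x ks h₁) (hk : Toks (List.ofFn G) h₂)
    (hu : h.IsDisjointUnion h₁ h₂) {q : Fin Q} {L : List (Fin K)} (hL : L.length = m + 2)
    (ha : Accepts δ q L) :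
    PredSat (rules δ m) (simP K m q) ((x :: (List.ofFn G ++ L.map G)).map lval) h := by
  have len : ∀ {c : Fin K} {B l}, (c :: (B ++ [l])).length = m + 2 → B.length = m := by
    intro c B l h
    simpa using h
  induction ht generalizing q L h with
  | @nil x h₁ hs =>
    have key : ∀ c B l, (c :: (B ++ [l])).length = m + 2 → PredSat (rules δ m) (simP K m q)
        ((x :: (List.ofFn G ++ (c :: (B ++ [l])).map G)).map lval) h := by
      intro c B l hL
      refine predSat_of_mkRule (simEnd_mem q) (cfgStore_params G x x c l (len hL)) (by simp) hu
        ?_ ?_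
      · rw [cfgStore_zero, List.map_cons, map_eval_lv, cfgStore_ys]
        exact hs
      · rw [toks_calls, cfgStore_ys]
        exact hk
    cases ha with
    | acc => exact key _ _ _ hL
    | go => exact key _ _ _ hL
  | @cons x z h₁ h₃ h₄ k ks hu' hs htr ih =>
    obtain ⟨e, hu₁, hu₂⟩ := hu.assoc hu'
    have esc : ∀ {c B l}, c ≠ k → δ q k ≠ .acc → (c :: (B ++ [l])).length = m + 2 →
        PredSat (rules δ m) (simP K m q)
          ((x :: (List.ofFn G ++ (c :: (B ++ [l])).map G)).map lval) h := by
      intro c B l hck hacc hL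
      refine predSat_of_escape (ξ := [mismatch K k]) (actRules_mem (q := q) (k := k) ?_) (len hL) ?_
        hu₁ hs hu₂ htr hk
      · cases hd : δ q k with
        | acc => exact absurd hd hacc
        | rej => simp [actRules]
        | go => simp [actRules]
      · rw [List.forall_mem_singleton]
        intro heq
        rw [eval_lv, eval_lv, (cfgStore_cells G x z c l).1,
          of_vals_ys (cfgStore_ys G x z c l) k] at heq
        exact hck (hG (lval_injective heq))
    have escAcc : ∀ {c B l}, δ q k = .acc → (c :: (B ++ [l])).length = m + 2 →
        PredSat (rules δ m) (simP K m q)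
          ((x :: (List.ofFn G ++ (c :: (B ++ [l])).map G)).map lval) h := by
      intro c B l hacc hL
      exact predSat_of_escape (ξ := []) (actRules_mem (q := q) (k := k) (by simp [hacc, actRules])) (len hL)
        (by simp) hu₁ hs hu₂ htr hk
    by_cases hacc : δ q k = .acc
    · cases ha with
      | acc => exact escAcc hacc hL
      | go => exact escAcc hacc hL
    cases ha with
    | @acc _ c B l hd =>
      by_cases hck : c = k
      · rw [hck] at hd
        exact absurd hd hacc
      · exact esc hck hacc hL
    | @go _ c B l q' c' mv hd ha =>
      by_cases hck : c = k
      · subst hck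
        have hB := len hL
        have hg := cfgStore_gs G x z c (B := B) l
        obtain ⟨ha', hl', hz'⟩ := cfgStore_cells G x z c (B := B) l
        refine predSat_of_mkRule (p := simP K m q)
          (actRules_mem (r := simStep K m q c q' c' mv) (q := q) (k := c)
            (by simp [hd, actRules]))
          (cfgStore_params G x z c l hB) (by simp) hu₁ ?_ ?_
        · rw [cfgStore_zero, List.map_cons, List.map_append, map_eval_lv, vals_set, hg, ha',
            List.map_singleton, eval_lv, hz']
          have : (List.ofFn G).set c (G c) = List.ofFn G := by
            refine List.ext_getElem (by simp) fun i h₁ h₂ => ?_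
            rw [List.getElem_set]
            split
            · subst_vars; simp
            · rfl
          rw [this]
          exact hs
        · refine listSat_singleton.2 ?_
          rw [List.map_cons, map_eval_lv, vals_append, vals_rot, hg, hl', eval_lv, hz',
            of_vals_gs hg, cfgStore, vals_mid (m := m) (by simp) (by simp) (by simpa using hB),
            ← map_rot]
          exact ih hu₂ (by simp [hB]) ha
      · exact esc hck hacc hL

/-- If the machine rejects, then the simulation fails on the trace of the run. -/
theorem Rejects.not_predSat {G : Fin K → I.U .loc} {ks : List (Fin K)}
    {x : I.U .loc} {h h₁ : I.Heap} {q : Fin Q} {L : List (Fin K)} (hr : Rejects δ q L ks)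
    (ht : Trace G x ks h₁) (hsub : ∀ l v, h₁.map l = some v → h.map l = some v)
    (hL : L.length = m + 2) :
    ¬ PredSat (rules δ m) (simP K m q) ((x :: (List.ofFn G ++ L.map G)).map lval) h := by
  -- The cell at the root is determined by the trace.
  have cell : ∀ {x z : I.U .loc} {k : Fin K} {h c₁ c₂ : I.Heap} {s : I.Store} {ts : List Term},
      h.map x = some (cval I k :: ((List.ofFn G).map lval ++ [lval z])) →
      h.IsDisjointUnion c₁ c₂ → c₁.IsSingleton x (ts.map s.eval) →
      ts.map s.eval = cval I k :: ((List.ofFn G).map lval ++ [lval z]) := by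
    intro x z k h c₁ c₂ s ts hx hu hs
    have := hu.map_left hs.1
    rw [hx] at this
    exact (Option.some.inj this).symm
  have params : ∀ {s : I.Store} {x : I.U .loc} {c l : Fin K} {B : List (Fin K)},
      (vals s (0 :: simParams K m)).map lval =
        (x :: (List.ofFn G ++ (c :: (B ++ [l])).map G)).map lval → B.length = m →
      s (locVar 0) = x ∧ vals s (gs K) = List.ofFn G ∧ s (locVar (hd K)) = G c ∧
        vals s (mid K m) = B.map G ∧ s (locVar (lst K)) = G l := by
    intro s x c l B hv hB
    have hv := lval_injective.list_map hv
    rw [vals_cons, vals_append, vals_cons, vals_append, vals_cons, List.cons.injEq] at hv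
    obtain ⟨h0, hv⟩ := hv
    obtain ⟨hg, hv⟩ := List.append_inj hv (by simp [vals])
    rw [List.map_cons, List.cons.injEq, List.map_append] at hv
    obtain ⟨hc, hv⟩ := hv
    obtain ⟨hm, hv⟩ := List.append_inj hv (by simp [vals, hB])
    exact ⟨h0, hg, hc, hm, by simpa [vals] using hv⟩
  -- Rules other than those for the symbol at hand do not match the cell, and the escape for this
  -- symbol is excluded by its disequation.
  have key : ∀ {q : Fin Q} {x z : I.U .loc} {c l : Fin K} {B : List (Fin K)} {h : I.Heap},
      B.length = m → δ q c ≠ .acc →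
      h.map x = some (cval I c :: ((List.ofFn G).map lval ++ [lval z])) →
      PredSat (rules δ m) (simP K m q)
        ((x :: (List.ofFn G ++ (c :: (B ++ [l])).map G)).map lval) h →
      ∃ q' c' mv, δ q c = .go q' c' mv ∧ ∃ c₁ c₂ : I.Heap, h.IsDisjointUnion c₁ c₂ ∧
        (∀ y, y ≠ x → c₁.map y = none) ∧
        PredSat (rules δ m) (simP K m q')
          ((z :: (List.ofFn G ++ (rot mv c' B l).map G)).map lval) c₂ := by
    rintro q x z c l B h hB hacc hx ⟨r, hr, hh, s, hv, hp, hb⟩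
    rw [satSpatial_iff] at hb
    obtain rfl | rfl | ⟨k, hr⟩ := rule_of_head_simP hr hh
    · obtain ⟨c₁, c₂, hu, hs, -⟩ := hb
      rw [simEnd, mkRule_vars_eval] at hv
      rw [(params hv hB).1] at hs
      have := cval_injective (List.cons.inj (cell hx hu hs)).1
      omega
    · obtain ⟨c₁, c₂, hu, hs, -⟩ := hb
      rw [simDump, mkRule_vars_eval] at hv
      rw [(params hv hB).1] at hs
      have := cval_injective (List.cons.inj (cell hx hu hs)).1
      omega
    · obtain ⟨ha, rfl⟩ | ⟨ha, rfl⟩ | ⟨q', c', mv, ha, rfl⟩ := mem_actRules hr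
      · obtain ⟨c₁, c₂, hu, hs, -⟩ := hb
        rw [simEscape, mkRule_vars_eval] at hv
        rw [(params hv hB).1] at hs
        obtain rfl := Fin.ext (cval_injective (List.cons.inj (cell hx hu hs)).1)
        exact absurd ha hacc
      · obtain ⟨c₁, c₂, hu, hs, -⟩ := hb
        rw [simEscape, mkRule_vars_eval] at hv
        obtain ⟨h0, -, hc, -⟩ := params hv hB
        rw [h0] at hs
        have hcell := cell hx hu hs
        obtain rfl := Fin.ext (cval_injective (List.cons.inj hcell).1)
        have hy := (List.append_inj (by simpa only [List.map_append, List.map_cons, map_eval_lv]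
          using (List.cons.inj hcell).2) (by simp [vals])).1
        have hy := of_vals_ys (lval_injective.list_map hy) k
        refine absurd ?_ (hp _ (List.mem_singleton_self _))
        rw [eval_lv, eval_lv, hc, hy]
      · obtain ⟨c₁, c₂, hu, hs, hrest⟩ := hb
        rw [simStep, mkRule_vars_eval] at hv
        obtain ⟨h0, hg, hc, hm, hl⟩ := params hv hB
        rw [h0] at hs
        have hcell := cell hx hu hs
        obtain rfl := Fin.ext (cval_injective (List.cons.inj hcell).1)
        have hz := (List.append_inj (by simpa only [List.map_append, List.map_cons, map_eval_lv]
          using (List.cons.inj hcell).2) (by simp [vals])).2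
        have hz : s (locVar (nx K)) = z := by
          simpa [eval_lv, lval_injective.eq_iff] using hz
        refine ⟨q', c', mv, ha, c₁, c₂, hu, hs.2, ?_⟩
        have := listSat_singleton.1 hrest
        rw [List.map_cons, map_eval_lv, vals_append, vals_rot, hg, hl, eval_lv, hz,
            of_vals_gs hg, hm, ← map_rot] at this
        exact this
  induction hr generalizing x h h₁ with
  | @rej q c B l hd =>
    intro H
    cases ht with
    | cons hu hs ht =>
      obtain ⟨q', c', mv, hd', -⟩ := key (by simpa using hL) (by simp [hd])
        (hsub _ _ (hu.map_left hs.1)) H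
      rw [hd] at hd'
      cases hd'
  | @go q c B l q' c' mv ks hd _ ih =>
    intro H
    cases ht with
    | cons hu hs ht =>
      obtain ⟨q'', c'', mv', hd', c₁, c₂, hu', hc₁, H⟩ := key (by simpa using hL) (by simp [hd])
        (hsub _ _ (hu.map_left hs.1)) H
      rw [hd] at hd'
      cases hd'
      refine ih ht ?_ (by simpa using hL) H
      intro y v hy
      have hne : y ≠ _ := fun hyx => by
        rcases hu.1 y with h | h
        · rw [hyx, hs.1] at h; cases h
        · rw [hy] at h; cases h
      have := hsub _ _ (hu.map_right hy)
      rwa [hu'.2, hc₁ y hne, Option.none_or] at this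

/-! ### Counter-models -/

/-- There is a heap for every trace, and it can avoid any given finite set of locations. -/
theorem exists_trace (G : Fin K → I.U .loc) (ks : List (Fin K)) (F : Set (I.U .loc))
    (hF : F.Finite) : ∃ x h, Trace G x ks h ∧ x ∉ F ∧ ∀ l ∈ F, h.map l = none := by
  have := I.infinite .loc
  induction ks with
  | nil =>
    obtain ⟨x, hx⟩ := hF.exists_notMem
    exact ⟨x, _, .nil (Interp.Heap.isSingleton_single _ _), hx,
      fun l hl => (Interp.Heap.isSingleton_single _ _).2 l fun h => hx (h ▸ hl)⟩
  | cons k ks ih =>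
    obtain ⟨z, h, ht, -, hh⟩ := ih
    obtain ⟨x, hx⟩ := (hF.union h.finite_dom).exists_notMem
    simp only [Set.mem_union, Set.mem_ofPred_eq, not_or, not_not] at hx
    have hs := Interp.Heap.isSingleton_single x
      (cval I k :: ((List.ofFn G).map lval ++ [lval z]))
    refine ⟨x, .union _ h, .cons ⟨fun l => ?_, fun l => rfl⟩ hs ht, hx.1, fun l hl => ?_⟩
    · by_cases hl : l = x
      · exact .inr (hl ▸ hx.2)
      · exact .inl (hs.2 l hl)
    · simp only [Interp.Heap.union, hh l hl, Option.or_none]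
      exact hs.2 l fun h => hx.1 (h ▸ hl)

theorem exists_toks {vs : List (I.U .loc)} (hvs : vs.Nodup) :
    ∃ h, Toks vs h ∧ ∀ l ∉ vs, h.map l = none := by
  induction vs with
  | nil => exact ⟨.empty, fun _ => rfl, fun _ _ => rfl⟩
  | cons v vs ih =>
    obtain ⟨hv, hvs⟩ := List.nodup_cons.1 hvs
    obtain ⟨h, hk, hh⟩ := ih hvs
    have hs := Interp.Heap.isSingleton_single (I := I) v []
    refine ⟨.union _ h, ⟨_, h, ⟨fun l => ?_, fun l => rfl⟩, hs, hk⟩, fun l hl => ?_⟩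
    · by_cases hl : l = v
      · exact .inr (hl ▸ hh v hv)
      · exact .inl (hs.2 l hl)
    · rw [List.mem_cons, not_or] at hl
      simp only [Interp.Heap.union, hh l hl.2, Option.or_none]
      exact hs.2 l hl.1

theorem sequent_lhs_sat {q₀ : Fin Q} {L : List (Fin K)} {s : I.Store} {h : I.Heap} :
    (sequent δ m q₀ L).lhs.Sat (rules δ m) s h ↔ ∃ h₁ h₂ : I.Heap, h.IsDisjointUnion h₁ h₂ ∧
      (∃ ks, Trace (fun k : Fin K => s (locVar (1 + k))) (s (locVar 0)) ks h₁) ∧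
      Toks (List.ofFn fun k : Fin K => s (locVar (1 + k))) h₂ := by
  have : (sequent δ m q₀ L).lhs.Sat (rules δ m) s h ↔ SatSpatial (rules δ m) s h _ :=
    and_iff_left (by simp [sequent])
  rw [this, satSpatial_iff]
  refine exists_congr fun h₁ => exists_congr fun h₂ => and_congr_right fun _ => and_congr ?_ ?_
  · rw [List.map_cons, map_eval_lv, vals_range']
    exact ⟨trace_of_predSat, fun ⟨ks, ht⟩ => ht.predSat⟩
  · rw [listSat_toks, vals_range']

theorem sequent_rhs_sat {q₀ : Fin Q} {L : List (Fin K)} {s : I.Store} {h : I.Heap} :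
    (sequent δ m q₀ L).rhs.Sat (rules δ m) s h ↔ PredSat (rules δ m) (simP K m q₀)
      ((s (locVar 0) :: ((List.ofFn fun k : Fin K => s (locVar (1 + k))) ++
        L.map fun k : Fin K => s (locVar (1 + k)))).map lval) h := by
  have : (sequent δ m q₀ L).rhs.Sat (rules δ m) s h ↔ SatSpatial (rules δ m) s h _ :=
    and_iff_left (by simp [sequent])
  rw [this, satSpatial_iff]
  refine listSat_singleton.trans ?_
  rw [List.map_cons, List.map_append, map_eval_lv, vals_range']
  simp [eval_lv, Function.comp_def]

theorem Accepts.valid (I : Interp) {q₀ : Fin Q} {L : List (Fin K)} (hL : L.length = m + 2)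
    (ha : Accepts δ q₀ L) : (sequent δ m q₀ L).Valid I := by
  rintro ⟨s, h, hl, hr⟩
  obtain ⟨h₁, h₂, hu, ⟨ks, ht⟩, hk⟩ := sequent_lhs_sat.1 hl
  exact hr (sequent_rhs_sat.2 (ha.predSat (List.nodup_ofFn.1 hk.nodup.1) ht hk hu hL))

theorem Rejects.not_valid (I : Interp) {q₀ : Fin Q} {L ks : List (Fin K)} (hL : L.length = m + 2)
    (hr : Rejects δ q₀ L ks) : ¬ (sequent δ m q₀ L).Valid I := by
  intro hvalid
  have := I.infinite .loc
  let g : ℕ → I.U .loc := Infinite.natEmbedding _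
  have hg : Function.Injective g := (Infinite.natEmbedding _).injective
  let G : Fin K → I.U .loc := fun k => g (1 + k)
  have hG : Function.Injective G := fun i j h => Fin.ext (by have := hg h; omega)
  obtain ⟨x, h₁, ht, hx, hh₁⟩ := exists_trace G ks {l | l ∈ List.ofFn G} (List.finite_toSet _)
  obtain ⟨h₂, hk, hh₂⟩ := exists_toks (List.nodup_ofFn.2 hG)
  let s : I.Store := storeOf fun i => if i = 0 then x else g i
  have hs0 : s (locVar 0) = x := rfl
  have hsG : (fun k : Fin K => s (locVar (1 + k))) = G := by
    funext k
    simp [s, storeOf, G]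
  have hu : (h₁.union h₂).IsDisjointUnion h₁ h₂ := by
    refine ⟨fun l => ?_, fun l => rfl⟩
    by_cases hl : l ∈ List.ofFn G
    · exact .inl (hh₁ l hl)
    · exact .inr (hh₂ l hl)
  refine hvalid ⟨s, h₁.union h₂, sequent_lhs_sat.2 ⟨h₁, h₂, hu, ?_, ?_⟩, fun hr' => ?_⟩
  · rw [hsG, hs0]
    exact ⟨ks, ht⟩
  · rw [hsG]
    exact hk
  · have H := sequent_rhs_sat.1 hr'
    rw [hsG, hs0] at H
    exact hr.not_predSat ht (fun l v => hu.map_left) hL H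

end SL

/-! ### Simulation of a Turing machine by a rotating machine -/

namespace SL

open Complexity

variable {Q K : ℕ}

/-- One step of a rotating machine. -/
inductive Next (δ : Fin Q → Fin K → Act Q K) : Fin Q × List (Fin K) → Fin Q × List (Fin K) → Prop
  | mk {q c B l q' c' mv} : δ q c = .go q' c' mv →
      Next δ (q, c :: (B ++ [l])) (q', rot mv c' B l)

theorem Accepts.of_next {δ : Fin Q → Fin K → Act Q K} {x y : Fin Q × List (Fin K)}
    (h : Relation.ReflTransGen (Next δ) x y) (ha : Accepts δ y.1 y.2) : Accepts δ x.1 x.2 := by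
  induction h using Relation.ReflTransGen.head_induction_on with
  | refl => exact ha
  | head h _ ih =>
    cases h with
    | mk hd => exact .go hd ih

theorem Rejects.of_next {δ : Fin Q → Fin K → Act Q K} {x y : Fin Q × List (Fin K)}
    (h : Relation.ReflTransGen (Next δ) x y) {ks : List (Fin K)} (hr : Rejects δ y.1 y.2 ks) :
    ∃ ks, Rejects δ x.1 x.2 ks := by
  induction h using Relation.ReflTransGen.head_induction_on with
  | refl => exact ⟨ks, hr⟩
  | head h _ ih =>
    cases h with
    | mk hd => exact ih.imp' (List.cons _) fun _ => .go hd

/-- The first `S` cells of the tape `f` and the end marker `e`, arranged in a cycle that is read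
from the position `h` of the head on. -/
def cyc {α : Type} (f : ℕ → α) (e : α) (S h : ℕ) : List α :=
  f h :: ((List.range' (h + 1) (S - (h + 1))).map f ++ e :: (List.range' 0 h).map f)

section cyc

variable {α : Type} (f : ℕ → α) (e : α) {S h : ℕ}

theorem map_range'_update {f : ℕ → α} {a n i : ℕ} (c : α) (h : i < a ∨ a + n ≤ i) :
    (List.range' a n).map (Function.update f i c) = (List.range' a n).map f := by
  refine List.map_congr_left fun j hj => Function.update_of_ne ?_ _ _
  rw [List.mem_range'_1] at hj
  omega

theorem exists_cyc_eq : ∃ B l, cyc f e S h = f h :: (B ++ [l]) := by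
  obtain h' | ⟨B, l, h'⟩ := List.eq_nil_or_concat'
    ((List.range' (h + 1) (S - (h + 1))).map f ++ e :: (List.range' 0 h).map f)
  · simp at h'
  · exact ⟨B, l, by rw [cyc, h']⟩

theorem cyc_stay {B : List α} {l : α} (H : cyc f e S h = f h :: (B ++ [l])) (c : α) :
    rot .stay c B l = cyc (Function.update f h c) e S h := by
  rw [rot, ← (List.cons.inj H).2, cyc, Function.update_self, map_range'_update c (by omega),
    map_range'_update c (by omega)]

theorem cyc_right (hS : h + 1 < S) {B : List α} {l : α} (H : cyc f e S h = f h :: (B ++ [l]))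
    (c : α) : rot .right c B l = cyc (Function.update f h c) e S (h + 1) := by
  have : rot .right c B l = B ++ [l] ++ [c] := by simp [rot]
  obtain ⟨n, hn⟩ : ∃ n, S - (h + 1) = n + 1 := ⟨S - (h + 1) - 1, by omega⟩
  have hn' : S - (h + 1 + 1) = n := by omega
  rw [this, ← (List.cons.inj H).2, cyc, hn, hn', map_range'_update c (by omega),
    Function.update_of_ne (by omega), List.range'_succ, List.range'_1_concat, List.map_append,
    map_range'_update c (by omega)]
  simp

theorem cyc_left (hS : h + 1 < S) {B : List α} {l : α}
    (H : cyc f e S (h + 1) = f (h + 1) :: (B ++ [l])) (c : α) :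
    rot .left c B l = cyc (Function.update f (h + 1) c) e S h := by
  obtain ⟨n, hn⟩ : ∃ n, S - (h + 1) = n + 1 := ⟨S - (h + 1) - 1, by omega⟩
  have hn' : S - (h + 1 + 1) = n := by omega
  have H' := (List.cons.inj H).2
  rw [hn', List.range'_1_concat, List.map_append, ← List.cons_append, ← List.append_assoc] at H'
  obtain ⟨hB, hl⟩ := List.append_inj' H' (by simp)
  simp only [List.map_cons, List.map_nil, List.cons.injEq, and_true, Nat.zero_add] at hl
  rw [rot, ← hB, ← hl, cyc, hn, Function.update_of_ne (by omega), List.range'_succ, List.map_cons,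
    Function.update_self, map_range'_update c (by omega), map_range'_update c (by omega)]
  rfl

/-- A move to the left from the first cell leads to the end marker; a move to the right from there
leads back to the first cell. -/
theorem cyc_left_zero {B : List α} {l : α} (H : cyc f e S 0 = f 0 :: (B ++ [l])) (c : α) :
    ∃ B' l', rot .left c B l = e :: (B' ++ [l']) ∧
      rot .right e B' l' = cyc (Function.update f 0 c) e S 0 := by
  obtain ⟨hB, hl⟩ := List.append_inj' (List.cons.inj H).2 (by simp)
  simp only [List.range'_zero, List.map_nil, List.cons.injEq, and_true] at hl
  obtain h' | ⟨B', l', h'⟩ := List.eq_nil_or_concat' (c :: B)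
  · cases h'
  · refine ⟨B', l', by rw [rot, ← hl, h'], ?_⟩
    have : rot .right e B' l' = B' ++ [l'] ++ [e] := by simp [rot]
    rw [this, ← h', ← hB, cyc, Function.update_self, map_range'_update c (by omega)]
    rfl

end cyc

section machine

variable {A : Type} (M : TM A)

/-- The number of states. -/
noncomputable abbrev numQ : ℕ := Nat.card M.Q

/-- The number of symbols, including the end marker. -/
noncomputable abbrev numK : ℕ := Nat.card (Option M.Γ)

/-- A numbering of the states. -/
noncomputable def eQ : M.Q ≃ Fin (numQ M) :=
  haveI := M.finQ
  Finite.equivFin M.Q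

/-- A numbering of the symbols; `none` is the end marker. -/
noncomputable def eK : Option M.Γ ≃ Fin (numK M) :=
  haveI := M.finΓ
  Finite.equivFin (Option M.Γ)

open Classical in
/-- The rotating machine for `M`: on the end marker it moves to the right, and it accepts or rejects
when `M` halts. -/
noncomputable def machineAct (q : Fin (numQ M)) (k : Fin (numK M)) : Act (numQ M) (numK M) :=
  match (eK M).symm k with
  | none => .go q k .right
  | some a =>
    match M.trans ((eQ M).symm q) a with
    | some x => .go (eQ M x.1) (eK M (some x.2.1)) x.2.2
    | none => if (eQ M).symm q ∈ M.final then .acc else .rej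

/-- The configuration of the rotating machine that represents a configuration of `M`. -/
noncomputable def machineCfg (S : ℕ) (c : M.Cfg) : Fin (numQ M) × List (Fin (numK M)) :=
  (eQ M c.state, cyc (fun i => eK M (some (c.tape i))) (eK M none) S c.head)

variable {M}

theorem machineAct_marker (q : Fin (numQ M)) :
    machineAct M q (eK M none) = .go q (eK M none) .right := by
  simp [machineAct]

theorem machineAct_step {q q' : M.Q} {a b : M.Γ} {mv : Move} (h : M.trans q a = some (q', b, mv)) :
    machineAct M (eQ M q) (eK M (some a)) = .go (eQ M q') (eK M (some b)) mv := by
  simp [machineAct, h]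

open Classical in
theorem machineAct_halt {q : M.Q} {a : M.Γ} (h : M.trans q a = none) :
    machineAct M (eQ M q) (eK M (some a)) = if q ∈ M.final then .acc else .rej := by
  simp [machineAct, h]

theorem next_of_step {S : ℕ} {c c' : M.Cfg} (hc : c.head < S) (hc' : c'.head < S)
    (h : M.Step c c') :
    Relation.ReflTransGen (Next (machineAct M)) (machineCfg M S c) (machineCfg M S c') := by
  obtain ⟨q, b, mv, ht⟩ := h
  have hact := machineAct_step ht
  obtain ⟨B, l, hB⟩ := exists_cyc_eq (fun i => eK M (some (c.tape i))) (eK M none) (S := S)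
    (h := c.head)
  have hup : (fun i => eK M (some (Function.update c.tape c.head b i))) =
      Function.update (fun i => eK M (some (c.tape i))) c.head (eK M (some b)) := by
    funext i
    by_cases hi : i = c.head
    · subst hi; simp
    · simp [hi]
  simp only [machineCfg, hup]
  simp only [Move.apply] at hc' ⊢
  rw [hB]
  have hstep := Next.mk (B := B) (l := l) hact
  cases mv with
  | stay =>
    rw [cyc_stay _ _ hB] at hstep
    exact .single hstep
  | right =>
    rw [cyc_right _ _ hc' hB] at hstep
    exact .single hstep
  | left =>
    rcases c with ⟨q₀, h, f⟩
    cases h with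
    | zero =>
      obtain ⟨B', l', h₁, h₂⟩ := cyc_left_zero _ _ hB (eK M (some b))
      rw [h₁] at hstep
      have hback := Next.mk (B := B') (l := l') (machineAct_marker (M := M) (eQ M q))
      rw [h₂] at hback
      exact .head hstep (.single hback)
    | succ h =>
      rw [cyc_left _ _ hc hB] at hstep
      exact .single hstep

theorem next_of_reaches {S : ℕ} {w : List A} (hS : ∀ c, M.Reaches w c → c.head < S) {c : M.Cfg}
    (h : M.Reaches w c) :
    Relation.ReflTransGen (Next (machineAct M)) (machineCfg M S (M.init w))
      (machineCfg M S c) := by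
  induction h with
  | refl => exact .refl
  | @tail c c' h hstep ih => exact ih.trans (next_of_step (hS c h) (hS c' (h.tail hstep)) hstep)

theorem accepts_of_halted {S : ℕ} {c : M.Cfg} (hh : c.Halted) (hf : c.state ∈ M.final) :
    Accepts (machineAct M) (machineCfg M S c).1 (machineCfg M S c).2 := by
  obtain ⟨B, l, hB⟩ := exists_cyc_eq (fun i => eK M (some (c.tape i))) (eK M none) (S := S)
    (h := c.head)
  simp only [machineCfg, hB]
  exact .acc (by rw [machineAct_halt hh, if_pos hf])

theorem rejects_of_halted {S : ℕ} {c : M.Cfg} (hh : c.Halted) (hf : c.state ∉ M.final) :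
    ∃ ks, Rejects (machineAct M) (machineCfg M S c).1 (machineCfg M S c).2 ks := by
  obtain ⟨B, l, hB⟩ := exists_cyc_eq (fun i => eK M (some (c.tape i))) (eK M none) (S := S)
    (h := c.head)
  simp only [machineCfg, hB]
  exact ⟨_, .rej (by rw [machineAct_halt hh, if_neg hf])⟩

/-- The initial cyclic tape. -/
theorem machineCfg_init (w : List A) (t : ℕ) :
    machineCfg M (w.length + t + 1) (M.init w) =
      (eQ M M.start, w.map (fun a => eK M (some (M.input a))) ++
        (List.replicate (t + 1) (eK M (some M.blank)) ++ [eK M none])) := by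
  refine Prod.ext rfl ?_
  have : ∀ f : ℕ → Fin (numK M), cyc f (eK M none) (w.length + t + 1) 0 =
      (List.range (w.length + (t + 1))).map f ++ [eK M none] := by
    intro f
    rw [List.range_eq_range', ← Nat.add_assoc, List.range'_succ]
    simp [cyc]
  simp only [machineCfg, TM.init]
  rw [this, ← List.append_assoc]
  congr 1
  refine List.ext_getElem (by simp) fun i h₁ h₂ => ?_
  by_cases hi : i < w.length
  · simp [hi]
  · simp [hi, List.getElem_append]

/-- The sequent for the word `w`, where `p` bounds the space used by `M`. -/
noncomputable def machineSequent (M : TM A) (p : Polynomial ℕ) (w : List A) : Sequent :=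
  sequent (machineAct M) ((Polynomial.X + p).eval w.length) (eQ M M.start)
    (w.map (fun a => eK M (some (M.input a))) ++
      (List.replicate ((p + 1).eval w.length) (eK M (some M.blank)) ++ [eK M none]))

theorem emits_machineSequent [Finite A] (p : Polynomial ℕ) :
    StackProg.EmitsCode sequentCode (machineSequent M p) :=
  emits_sequent (Polynomial.X + p) (p + 1) (machineAct M) (eQ M M.start)
    (fun a => eK M (some (M.input a))) (eK M (some M.blank)) (eK M none)

theorem machineSequent_isDetPLoc (I : Interp) (p : Polynomial ℕ) (w : List A) :
    (machineSequent M p w).IsDetPLoc I := by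
  refine sequent_isDetPLoc I _ _ ?_
  simp only [List.length_append, List.length_map, List.length_replicate, List.length_singleton,
    Polynomial.eval_add, Polynomial.eval_X, Polynomial.eval_one]
  omega

theorem machineSequent_valid_iff (I : Interp) {L : Language A} (hdec : M.Decides L)
    {p : Polynomial ℕ} (hspace : M.RunsInSpace fun n => p.eval n) (w : List A) :
    (machineSequent M p w).Valid I ↔ w ∈ L := by
  have hlen : (machineCfg M (w.length + p.eval w.length + 1) (M.init w)).2.length =
      w.length + p.eval w.length + 2 := by
    rw [machineCfg_init]
    simp only [List.length_append, List.length_map, List.length_replicate, List.length_singleton]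
    omega
  have heq : machineSequent M p w = sequent (machineAct M) (w.length + p.eval w.length)
      (machineCfg M (w.length + p.eval w.length + 1) (M.init w)).1
      (machineCfg M (w.length + p.eval w.length + 1) (M.init w)).2 := by
    rw [machineCfg_init, machineSequent, Polynomial.eval_add, Polynomial.eval_add,
      Polynomial.eval_X, Polynomial.eval_one]
  obtain ⟨c, hc, hh, hf⟩ := hdec w
  have hrun := next_of_reaches (S := w.length + p.eval w.length + 1)
    (fun c hc => (hspace w c hc).trans_le (by simp only []; omega)) hc
  rw [heq, ← hf]
  constructor
  · intro hvalid
    by_contra hfin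
    obtain ⟨ks, hr⟩ := rejects_of_halted (S := w.length + p.eval w.length + 1) hh hfin
    obtain ⟨ks, hr⟩ := Rejects.of_next hrun hr
    exact hr.not_valid I hlen hvalid
  · intro hfin
    exact (Accepts.of_next hrun (accepts_of_halted hh hfin)).valid I hlen

end machine

end SL

theorem mainTheorem5 (I : SL.Interp) :
    Complexity.PSpaceHardOn SL.sequentEncoding
      {S : SL.Sequent | S.IsDetPLoc I} {S : SL.Sequent | S.Valid I} := by
  rintro A _ L ⟨M, p, hdec, hspace⟩
  exact ⟨SL.machineSequent M p,
    StackProg.Emits.computable (eb := SL.sequentEncoding.encode) (SL.emits_machineSequent p),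
    fun w => ⟨SL.machineSequent_isDetPLoc I p w,
      (SL.machineSequent_valid_iff I hdec hspace w).symm⟩⟩
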